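/- Let $n,p\ge 1$. Let $\mathcal S_p(\mathbb R)$ be the space of real symmetric $p\times p$ matrices with its Borel $\sigma$-field and the measure $dX=\prod_{i\le j}dx_{i,j}$; "positive definite" and "$A>B$" refer to the Loewner order, and $(0_p,I_p)=\{A\in\mathcal S_p(\mathbb R): 0_p<A<I_p\}$. A matrix measure on $[0,1]$ is a $p\times p$ matrix $\mu=(\mu_{i,j})$ of signed measures on $[0,1]$ such that $\mu(A)$ is symmetric and nonnegative definite for every Borel set $A\subset[0,1]$ and $\mu([0,1])=I_p$. The $n$-th moment space is $$\mathcal M_n(\mathbb R)=\Big\{(S_1,\dots,S_n): S_j=\int_0^1x^j\,d\mu(x),\ j=1,\dots,n,\ \text{for some matrix measure }\mu\Big\}\subset\mathcal S_p(\mathbb R)^n ,$$ $\mathcal V(\mathcal M_n(\mathbb R))=\int_{\mathcal M_n(\mathbb R)}dS_1\cdots dS_n$ is its volume, and the uniform distribution $\mathcal U(\mathcal M_n(\mathbb R))$ is the law with density $\mathcal V(\mathcal M_n(\mathbb R))^{-1}I_{\mathcal M_n(\mathbb R)}$ with respect to $dS_1\cdots dS_n$. For $(S_1,\dots,S_n)\in\mathcal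 S_p(\mathbb R)^n$ put $S_0=I_p$ and define the block matrices $\underline H_{2m}=(S_{i+j})_{i,j=0}^{m}$, $\underline H_{2m+1}=(S_{i+j+1})_{i,j=0}^{m}$, $\overline H_{2m}=(S_{i+j+1}-S_{i+j+2})_{i,j=0}^{m-1}$, $\overline H_{2m+1}=(S_{i+j}-S_{i+j+1})_{i,j=0}^{m}$ and $\underline h_{2m}^T=(S_{m+1},\dots,S_{2m})$, $\underline h_{2m-1}^T=(S_m,\dots,S_{2m-1})$, $\overline h_{2m}^T=(S_m-S_{m+1},\dots,S_{2m-1}-S_{2m})$, $\overline h_{2m-1}^T=(S_m-S_{m+1},\dots,S_{2m-2}-S_{2m-1})$. Set $S_1^-=0_p$, $S_{k+1}^-=\underline h_k^T\underline H_{k-1}^{-1}\underline h_k$ for $k\ge1$, and $S_1^+=I_p$, $S_2^+=S_1$, $S_{k+1}^+=S_k-\overline h_k^T\overline H_{k-1}^{-1}\overline h_k$ for $k\ge2$. Whenever $S_k^+-S_k^->0_p$, the $k$-th symmetric canonical moment is $$U_k=(S_k^+-S_k^-)^{-1/2}(S_k-S_k^-)(S_k^+-S_k^-)^{-1/2}.$$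 For $a,b>\tfrac12(p-1)$ let $\Gamma_p(a)=\int_{X>0}(\det X)^{a-(p+1)/2}e^{-\mathrm{tr}X}\,dX$ and $B_p(a,b)=\Gamma_p(a)\Gamma_p(b)/\Gamma_p(a+b)$, and let $\mathrm{Beta}_p(a,b)$ be the law on $\mathcal S_p(\mathbb R)$ with density $B_p(a,b)^{-1}(\det X)^{a-(p+1)/2}(\det(I_p-X))^{b-(p+1)/2}I_{(0_p,I_p)}(X)$ with respect to $dX$. **Theorem.** $0<\mathcal V(\mathcal M_n(\mathbb R))<\infty$, and if $(S_1,\dots,S_n)\sim\mathcal U(\mathcal M_n(\mathbb R))$, then almost surely $S_k^+-S_k^->0_p$ for $k=1,\dots,n$, so that the canonical moments $U_1,\dots,U_n$ are almost surely defined; the distribution of $(U_1,\dots,U_n)$ is absolutely continuous with respect to $dU_1\cdots dU_n$, with density $$f(U_1,\dots,U_n)=\frac1{\mathcal V(\mathcal M_n(\mathbb R))}\prod_{k=1}^n\big(\det(U_k(I_p-U_k))\big)^{(p+1)(n-k)/2}\,I_{(0_p,I_p)}(U_k).$$ Hence $U_1,\dots,U_n$ are independent, and for $k=1,\dots,n$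 $$U_k\sim\mathrm{Beta}_p\big(\tfrac12(n-k+1)(p+1),\ \tfrac12(n-k+1)(p+1)\big).$$ -/

import Mathlib

open MeasureTheory ProbabilityTheory
open scoped MatrixOrder

namespace MatrixMoments

/-- The space of real symmetric `p × p` matrices. -/
def SymMat (p : ℕ) : Submodule ℝ (Matrix (Fin p) (Fin p) ℝ) where
  carrier := {A | A.IsSymm}
  add_mem' hA hB := hA.add hB
  zero_mem' := Matrix.isSymm_zero
  smul_mem' c _ hA := hA.smul c

/-- The Borel σ-algebra of the space of symmetric matrices. -/
instance instMeasurableSpaceSymMat (p : ℕ) : MeasurableSpace (SymMat p) := borel _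

instance instBorelSpaceSymMat (p : ℕ) : BorelSpace (SymMat p) := ⟨rfl⟩

/-- The symmetric matrix with prescribed entries on and above the diagonal. -/
def symOfUpper (p : ℕ) (x : {ij : Fin p × Fin p // ij.1 ≤ ij.2} → ℝ) : SymMat p :=
  ⟨Matrix.of fun i j => x ⟨(min i j, max i j), min_le_max⟩, by
    refine Matrix.IsSymm.ext fun i j => ?_
    simp only [Matrix.of_apply, min_comm, max_comm]⟩

/-- The measure `dX = ∏_{i ≤ j} dx_{ij}` on the symmetric matrices: Lebesgue measure in the
independent entries. -/
noncomputable def symLebesgue (p : ℕ) : Measure (SymMat p) :=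
  Measure.map (symOfUpper p) volume

/-- The measure `dX_1 ⋯ dX_n` on `n`-tuples of symmetric matrices. -/
noncomputable def tupleLebesgue (n p : ℕ) : Measure (Fin n → SymMat p) :=
  Measure.pi fun _ => symLebesgue p

/-- A (normalized) real matrix measure on `[0,1]`: a `p × p` matrix of signed measures whose value
on each Borel set is symmetric and nonnegative definite, and whose value on `[0,1]` is `I_p`. -/
structure MatrixMeasure (p : ℕ) where
  entry : Fin p → Fin p → SignedMeasure (Set.Icc (0 : ℝ) 1)
  posSemidef : ∀ A : Set (Set.Icc (0 : ℝ) 1), MeasurableSet A →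
    (Matrix.of fun i j => entry i j A).PosSemidef
  normalized : (Matrix.of fun i j => entry i j Set.univ) = 1

/-- The `k`-th moment `∫ x^k dμ(x)` of a matrix measure, taken entrywise. -/
noncomputable def MatrixMeasure.moment {p : ℕ} (μ : MatrixMeasure p) (k : ℕ) :
    Matrix (Fin p) (Fin p) ℝ :=
  Matrix.of fun i j => ∫ᵛ x, (x : ℝ) ^ k ∂•(μ.entry i j)

/-- The `n`-th moment space: all `(S_1, …, S_n)` that are the first `n` moments of a matrix measure
on `[0,1]`. The index `j : Fin n` stands for `S_{j+1}`. -/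
def momentSpace (n p : ℕ) : Set (Fin n → SymMat p) :=
  {S | ∃ μ : MatrixMeasure p, ∀ j : Fin n,
    (S j : Matrix (Fin p) (Fin p) ℝ) = μ.moment ((j : ℕ) + 1)}

/-- The volume of the moment space. -/
noncomputable def momentVolume (n p : ℕ) : ℝ := (tupleLebesgue n p (momentSpace n p)).toReal

/-- The sequence `S_0 = I_p, S_1, …, S_n` of a tuple, continued by `0`. -/
def momentSeq {n p : ℕ} (S : Fin n → SymMat p) : ℕ → Matrix (Fin p) (Fin p) ℝ
  | 0 => 1
  | k + 1 => if h : k < n then (S ⟨k, h⟩ : Matrix (Fin p) (Fin p) ℝ) else 0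

/-- The sequence of differences `S_j - S_{j+1}`. -/
def momentDiff {n p : ℕ} (S : Fin n → SymMat p) (j : ℕ) : Matrix (Fin p) (Fin p) ℝ :=
  momentSeq S j - momentSeq S (j + 1)

/-- The block Hankel matrix with `m × m` blocks, the block in position `(a, b)` being
`c_{s+a+b}`, where `a, b = 0, …, m-1`. -/
def blockHankel {p : ℕ} (c : ℕ → Matrix (Fin p) (Fin p) ℝ) (s m : ℕ) :
    Matrix (Fin m × Fin p) (Fin m × Fin p) ℝ :=
  Matrix.of fun a b => c (s + a.1 + b.1) a.2 b.2

/-- The column of the `m` blocks `c_s, c_{s+1}, …, c_{s+m-1}`. -/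
def blockColumn {p : ℕ} (c : ℕ → Matrix (Fin p) (Fin p) ℝ) (s m : ℕ) :
    Matrix (Fin m × Fin p) (Fin p) ℝ :=
  Matrix.of fun a j => c (s + a.1) a.2 j

/-- The lower Hankel matrix: for `N = 2m` it has the blocks `S_0, …, S_{2m}`, and for `N = 2m+1` the
blocks `S_1, …, S_{2m+1}`; in both cases there are `(m+1) × (m+1)` blocks. -/
def lowerHankel {n p : ℕ} (S : Fin n → SymMat p) (N : ℕ) :
    Matrix (Fin (N / 2 + 1) × Fin p) (Fin (N / 2 + 1) × Fin p) ℝ :=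
  blockHankel (momentSeq S) (N % 2) (N / 2 + 1)

/-- The upper Hankel matrix: for `N = 2m` it has the `m × m` blocks
`S_1 - S_2, …, S_{2m-1} - S_{2m}`, and for `N = 2m+1` the `(m+1) × (m+1)` blocks
`S_0 - S_1, …, S_{2m} - S_{2m+1}`. -/
def upperHankel {n p : ℕ} (S : Fin n → SymMat p) (N : ℕ) :
    Matrix (Fin ((N + 1) / 2) × Fin p) (Fin ((N + 1) / 2) × Fin p) ℝ :=
  blockHankel (momentDiff S) ((N + 1) % 2) ((N + 1) / 2)

/-- The lower vector belonging to `lowerHankel S N`: with `M = N + 1` it is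
`(S_{m+1}, …, S_{2m})` for `M = 2m` and `(S_m, …, S_{2m-1})` for `M = 2m-1`, as a column. -/
def lowerColumn {n p : ℕ} (S : Fin n → SymMat p) (N : ℕ) :
    Matrix (Fin (N / 2 + 1) × Fin p) (Fin p) ℝ :=
  blockColumn (momentSeq S) (N % 2 + (N / 2 + 1)) (N / 2 + 1)

/-- The upper vector belonging to `upperHankel S N`: with `M = N + 1` it is
`(S_m - S_{m+1}, …, S_{2m-1} - S_{2m})` for `M = 2m` and
`(S_m - S_{m+1}, …, S_{2m-2} - S_{2m-1})` for `M = 2m-1`, as a column. -/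
def upperColumn {n p : ℕ} (S : Fin n → SymMat p) (N : ℕ) :
    Matrix (Fin ((N + 1) / 2) × Fin p) (Fin p) ℝ :=
  blockColumn (momentDiff S) ((N + 1) % 2 + (N + 1) / 2) ((N + 1) / 2)

/-- The lower bound `S_k^-` of the `k`-th moment given `S_1, …, S_{k-1}`: `S_1^- = 0`, and
`S_{N+2}^- = hᵀ H⁻¹ h` with the lower Hankel matrix `H` of index `N`. The value at `k = 0` is not
used. -/
noncomputable def lowerMoment {n p : ℕ} (S : Fin n → SymMat p) : ℕ → Matrix (Fin p) (Fin p) ℝ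
  | 0 => 0
  | 1 => 0
  | N + 2 => (lowerColumn S N).transpose * (lowerHankel S N)⁻¹ * lowerColumn S N

/-- The upper bound `S_k^+` of the `k`-th moment given `S_1, …, S_{k-1}`: `S_1^+ = I_p`,
`S_2^+ = S_1`, and `S_{N+3}^+ = S_{N+2} - hᵀ H⁻¹ h` with the upper Hankel matrix `H` of index
`N + 1`. The value at `k = 0` is not used. -/
noncomputable def upperMoment {n p : ℕ} (S : Fin n → SymMat p) : ℕ → Matrix (Fin p) (Fin p) ℝ
  | 0 => 0
  | 1 => 1
  | 2 => momentSeq S 1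
  | N + 3 => momentSeq S (N + 2) -
      (upperColumn S (N + 1)).transpose * (upperHankel S (N + 1))⁻¹ * upperColumn S (N + 1)

/-- The width `S_k^+ - S_k^-` of the range of the `k`-th moment. -/
noncomputable def rangeWidth {n p : ℕ} (S : Fin n → SymMat p) (k : ℕ) :
    Matrix (Fin p) (Fin p) ℝ :=
  upperMoment S k - lowerMoment S k

lemma momentSeq_isSymm {n p : ℕ} (S : Fin n → SymMat p) (k : ℕ) : (momentSeq S k).IsSymm := by
  cases k with
  | zero => exact Matrix.isSymm_one
  | succ k =>
    simp only [momentSeq]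
    split_ifs with h
    · exact (S ⟨k, h⟩).2
    · exact Matrix.isSymm_zero

lemma blockHankel_isSymm {p : ℕ} {c : ℕ → Matrix (Fin p) (Fin p) ℝ} (hc : ∀ k, (c k).IsSymm)
    (s m : ℕ) : (blockHankel c s m).IsSymm := by
  refine Matrix.IsSymm.ext fun a b => ?_
  simp only [blockHankel, Matrix.of_apply]
  rw [(hc _).apply, add_right_comm]

lemma isSymm_conj {ι κ : Type*} [Fintype ι] [DecidableEq ι] {A : Matrix ι ι ℝ} (hA : A.IsSymm)
    (B : Matrix ι κ ℝ) : (B.transpose * A * B).IsSymm := by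
  unfold Matrix.IsSymm
  rw [Matrix.transpose_mul, Matrix.transpose_mul, Matrix.transpose_transpose, hA.eq,
    Matrix.mul_assoc]

lemma isSymm_inv {ι : Type*} [Fintype ι] [DecidableEq ι] {A : Matrix ι ι ℝ} (hA : A.IsSymm) :
    (A⁻¹).IsSymm := by
  unfold Matrix.IsSymm
  rw [Matrix.transpose_nonsing_inv, hA.eq]

lemma lowerMoment_isSymm {n p : ℕ} (S : Fin n → SymMat p) (k : ℕ) :
    (lowerMoment S k).IsSymm := by
  match k with
  | 0 => exact Matrix.isSymm_zero
  | 1 => exact Matrix.isSymm_zero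
  | N + 2 => exact isSymm_conj (isSymm_inv (blockHankel_isSymm (momentSeq_isSymm S) _ _)) _

/-- The symmetric canonical moment `U_{k+1} = D^{-1/2} (S_{k+1} - S_{k+1}^-) D^{-1/2}` with
`D = S_{k+1}^+ - S_{k+1}^-`. It has its intended meaning where `D` is positive definite, and
`CFC.sqrt` is then the positive definite square root. -/
noncomputable def canonicalMoment {n p : ℕ} (S : Fin n → SymMat p) (k : Fin n) : SymMat p :=
  ⟨(CFC.sqrt (rangeWidth S (k + 1)))⁻¹ *
      ((S k : Matrix (Fin p) (Fin p) ℝ) - lowerMoment S (k + 1)) *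
      (CFC.sqrt (rangeWidth S (k + 1)))⁻¹, by
    have hR : ((CFC.sqrt (rangeWidth S (k + 1)))⁻¹).IsSymm :=
      isSymm_inv (by
        have h := (Matrix.nonneg_iff_posSemidef.mp
          (CFC.sqrt_nonneg (rangeWidth S (k + 1)))).isHermitian
        simpa [Matrix.IsHermitian, Matrix.IsSymm, Matrix.conjTranspose_eq_transpose_of_trivial]
          using h)
    have h := isSymm_conj ((S k).2.sub (lowerMoment_isSymm S (k + 1)))
      (CFC.sqrt (rangeWidth S (k + 1)))⁻¹
    rw [hR.eq] at h
    exact h⟩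

/-- The open Loewner interval `(0_p, I_p)`. -/
def loewnerInterval (p : ℕ) : Set (SymMat p) :=
  {A | (A : Matrix (Fin p) (Fin p) ℝ).PosDef ∧ (1 - (A : Matrix (Fin p) (Fin p) ℝ)).PosDef}

/-- The joint density of the canonical moments:
`V(M_n)⁻¹ ∏_k det(U_k (I_p - U_k))^{(p+1)(n-k)/2} 1_{(0_p, I_p)}(U_k)`. The index `k : Fin n` stands
for `k + 1`. -/
noncomputable def canonicalDensity (n p : ℕ) (U : Fin n → SymMat p) : ℝ :=
  (momentVolume n p)⁻¹ * ∏ k : Fin n, (loewnerInterval p).indicator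
    (fun X : SymMat p => ((X : Matrix (Fin p) (Fin p) ℝ) * (1 - X)).det ^
      (((p : ℝ) + 1) * ((n : ℝ) - ((k : ℕ) + 1)) / 2)) (U k)

/-- The multivariate Gamma function
`Γ_p(a) = ∫_{X > 0} det(X)^{a - (p+1)/2} exp(-tr X) dX`. -/
noncomputable def multiGamma (p : ℕ) (a : ℝ) : ℝ :=
  ∫ X in {X : SymMat p | (X : Matrix (Fin p) (Fin p) ℝ).PosDef},
    (X : Matrix (Fin p) (Fin p) ℝ).det ^ (a - ((p : ℝ) + 1) / 2) *
      Real.exp (-(X : Matrix (Fin p) (Fin p) ℝ).trace) ∂(symLebesgue p)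

/-- The multivariate Beta function. -/
noncomputable def multiBeta (p : ℕ) (a b : ℝ) : ℝ :=
  multiGamma p a * multiGamma p b / multiGamma p (a + b)

/-- The density of the matrix variate Beta distribution `Beta_p(a, b)`. -/
noncomputable def betaDensity (p : ℕ) (a b : ℝ) : SymMat p → ℝ :=
  (loewnerInterval p).indicator fun X : SymMat p =>
    (multiBeta p a b)⁻¹ * (X : Matrix (Fin p) (Fin p) ℝ).det ^ (a - ((p : ℝ) + 1) / 2) *
      (1 - (X : Matrix (Fin p) (Fin p) ℝ)).det ^ (b - ((p : ℝ) + 1) / 2)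

/-- The matrix variate Beta distribution `Beta_p(a, b)`, for `a, b > (p-1)/2`. -/
noncomputable def betaLaw (p : ℕ) (a b : ℝ) : Measure (SymMat p) :=
  (symLebesgue p).withDensity fun X => ENNReal.ofReal (betaDensity p a b X)

end MatrixMoments

open MatrixMoments

/-! Write `D_k = S_k^+ - S_k^-`. The passage from moments to canonical moments is triangular: `U_k`
depends only on `S_1, …, S_k`, and for fixed earlier moments it is affine in `S_k`, namely `U_k =
D_k^{-1/2} (S_k - S_k^-) D_k^{-1/2}`. A congruence by a symmetric `C` has Jacobian `(det C)^{p+1}`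
on symmetric matrices (`det_congrMap`), so `dS_k = (det D_k)^{(p+1)/2} dU_k`.

It remains to express `det D_k` through the canonical moments. The gaps `A = S_k - S_k^-` and `B =
S_k^+ - S_k` are last Schur complements of block Hankel matrices of the moments and of their
differences. Comparing the monic orthogonal matrix polynomials for the weights `1`, `x`, `1-x` and
`x(1-x)` gives the recursion `D_{k+1} = A (A+B)⁻¹ B`, a parallel sum (`gap_parallel`). Taking
determinants yields `det D_{k+1} = ∏_{i ≤ k} det (U_i (1 - U_i))` (`det_rangeWidth`). In the product
of all Jacobians the factor of index `i` occurs once for every `k > i`, which produces the exponent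
`(p+1)(n-i)/2` (`lintegral_interiorSet`).

The integration domain is the set where all gaps are positive definite, and this is the moment space
up to a null set (`momentSpace_ae_eq`). Positive gaps give a representing measure: compress
multiplication by `x` to a symmetric matrix `T` with `0 ≤ T ≤ 1` and diagonalize it
(`exists_measure_of_gaps`). Conversely, moments have positive semidefinite Hankel matrices. The
semidefinite conditions define a convex set, whose frontier is null and whose interior has positive
definite gaps.

The joint density is a product of Beta kernels. Euler's relation (`lgamma_mul_lgamma`), with bounds
on the Gamma integral, shows that each Beta integral is positive, finite and equal to the
normalizing constant. The volume is the product of these integrals, so the joint law is the product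
of the Beta laws. -/

open MatrixMoments

namespace MatrixMoments

/-! ### Schur complements of block Hankel matrices, orthogonal matrix polynomials, and the parallel
sum recursion. -/

section Hankel

open Polynomial

variable {p : ℕ}

/-- The Schur complement of the last block in the block Hankel matrix with `m + 1` blocks. -/
noncomputable def schur (d : ℕ → Matrix (Fin p) (Fin p) ℝ) (s m : ℕ) : Matrix (Fin p) (Fin p) ℝ :=
  d (s + 2 * m) -
    (blockColumn d (s + m) m).transpose * (blockHankel d s m)⁻¹ * blockColumn d (s + m) m

/-- The sequence of differences. -/
def diffSeq (c : ℕ → Matrix (Fin p) (Fin p) ℝ) (j : ℕ) : Matrix (Fin p) (Fin p) ℝ :=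
  c j - c (j + 1)

lemma blockHankel_congr {d d' : ℕ → Matrix (Fin p) (Fin p) ℝ} {s m : ℕ}
    (h : ∀ i, i + 2 ≤ s + 2 * m → d i = d' i) : blockHankel d s m = blockHankel d' s m := by
  ext a b
  simp only [blockHankel, Matrix.of_apply]
  rw [h _ (by omega)]

lemma schur_zero (d : ℕ → Matrix (Fin p) (Fin p) ℝ) (s : ℕ) : schur d s 0 = d s := by
  ext i j
  simp [schur, Matrix.mul_apply]

/-- Splitting off the last block. -/
def lastBlockEquiv (m p : ℕ) : (Fin m × Fin p) ⊕ Fin p ≃ Fin (m + 1) × Fin p :=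
  ((Equiv.sumCongr (Equiv.refl _) (Equiv.uniqueProd (Fin p) (Fin 1)).symm).trans
    (Equiv.sumProdDistrib (Fin m) (Fin 1) (Fin p)).symm).trans
    (Equiv.prodCongr finSumFinEquiv (Equiv.refl _))

lemma blockHankel_succ {d : ℕ → Matrix (Fin p) (Fin p) ℝ} (hd : ∀ k, (d k).IsSymm) (s m : ℕ) :
    (blockHankel d s (m + 1)).submatrix (lastBlockEquiv m p) (lastBlockEquiv m p) =
      Matrix.fromBlocks (blockHankel d s m) (blockColumn d (s + m) m)
        (blockColumn d (s + m) m).conjTranspose (d (s + 2 * m)) := by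
  ext (⟨i, a⟩ | a) (⟨j, b⟩ | b)
  · simp [blockHankel, lastBlockEquiv]
  · simp [blockHankel, blockColumn, lastBlockEquiv, add_right_comm]
  · simp [blockHankel, blockColumn, lastBlockEquiv, (hd _).apply a b]
  · simp [blockHankel, lastBlockEquiv, two_mul, add_assoc]

/-- The semidefinite Schur complement criterion becomes strict because the determinant factors as
`det A` times that of the Schur complement. -/
lemma posDef_fromBlocks_iff {ι κ : Type*} [Fintype ι] [DecidableEq ι] [Fintype κ] [DecidableEq κ]
    {A : Matrix ι ι ℝ} (B : Matrix ι κ ℝ) (D : Matrix κ κ ℝ) (hA : A.PosDef) :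
    (Matrix.fromBlocks A B B.conjTranspose D).PosDef ↔
      (D - B.conjTranspose * A⁻¹ * B).PosDef := by
  have := hA.isUnit.invertible
  have hdet := Matrix.det_fromBlocks₁₁ A B B.conjTranspose D
  rw [Matrix.invOf_eq_nonsing_inv] at hdet
  have h0 := hA.det_pos.ne'
  constructor
  · intro h
    refine (((Matrix.PosDef.fromBlocks₁₁ B D hA).1 h.posSemidef).posDef_iff_det_ne_zero).2 ?_
    intro h1
    rw [h1, mul_zero] at hdet
    exact h.det_pos.ne' hdet
  · intro h
    refine (((Matrix.PosDef.fromBlocks₁₁ B D hA).2 h.posSemidef).posDef_iff_det_ne_zero).2 ?_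
    rw [hdet]
    exact mul_ne_zero h0 h.det_pos.ne'

lemma posDef_submatrix_equiv_iff {ι κ : Type*} [Fintype ι] [Fintype κ] {A : Matrix ι ι ℝ}
    (e : κ ≃ ι) : (A.submatrix e e).PosDef ↔ A.PosDef := by
  refine ⟨fun h => ?_, fun h => h.submatrix e.injective⟩
  have := h.submatrix e.symm.injective
  simpa using this

lemma blockHankel_posDef_succ_iff {d : ℕ → Matrix (Fin p) (Fin p) ℝ} (hd : ∀ k, (d k).IsSymm)
    (s m : ℕ) : (blockHankel d s (m + 1)).PosDef ↔
      (blockHankel d s m).PosDef ∧ (schur d s m).PosDef := by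
  rw [← posDef_submatrix_equiv_iff (lastBlockEquiv m p), blockHankel_succ hd]
  constructor
  · intro h
    have h1 : (blockHankel d s m).PosDef := by
      exact h.submatrix (e := Sum.inl) Sum.inl_injective
    exact ⟨h1, by simpa [schur] using (posDef_fromBlocks_iff _ _ h1).1 h⟩
  · rintro ⟨h1, h2⟩
    exact (posDef_fromBlocks_iff _ _ h1).2 (by simpa [schur] using h2)

lemma blockHankel_zero_posDef (d : ℕ → Matrix (Fin p) (Fin p) ℝ) (s : ℕ) :
    (blockHankel d s 0).PosDef :=
  Matrix.PosDef.of_dotProduct_mulVec_pos (by ext a; exact a.1.elim0)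
    fun x hx => (hx (funext fun a => a.1.elim0)).elim

lemma diffSeq_isSymm {c : ℕ → Matrix (Fin p) (Fin p) ℝ} (hc : ∀ k, (c k).IsSymm) (k : ℕ) :
    (diffSeq c k).IsSymm := (hc k).sub (hc (k + 1))

/-- The matrix with `m ≥ 1` blocks starting at `s` reaches index `s + 2m - 2`, so the bound selects
the matrices built from `d 0, …, d (N-1)`. Every index `k` is the corner of exactly one of them,
with parity `s = k % 2`; peeling off last blocks turns the Hankel conditions into one Schur
complement condition per index. -/
lemma blockHankel_posDef_iff {d : ℕ → Matrix (Fin p) (Fin p) ℝ} (hd : ∀ k, (d k).IsSymm)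
    (N : ℕ) : (∀ s < 2, ∀ m, s + 2 * m < N + 2 → (blockHankel d s m).PosDef) ↔
      ∀ k < N, (schur d (k % 2) (k / 2)).PosDef := by
  constructor
  · intro h k hk
    exact ((blockHankel_posDef_succ_iff hd _ _).1 (h (k % 2) (by omega) (k / 2 + 1) (by omega))).2
  · intro h s hs m hm
    induction m with
    | zero => exact blockHankel_zero_posDef d s
    | succ m ih =>
      refine (blockHankel_posDef_succ_iff hd _ _).2 ⟨ih (by omega), ?_⟩
      have := h (s + 2 * m) (by omega)
      rwa [show (s + 2 * m) % 2 = s by omega, show (s + 2 * m) / 2 = m by omega] at this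

/-- The distance `S_k - S_k^-` to the lower bound, for an infinite sequence. -/
noncomputable def lowerGap (c : ℕ → Matrix (Fin p) (Fin p) ℝ) (k : ℕ) :
    Matrix (Fin p) (Fin p) ℝ := schur c (k % 2) (k / 2)

/-- The distance `S_{k+1}^+ - S_{k+1}` to the upper bound, for an infinite sequence. -/
noncomputable def upperGap (c : ℕ → Matrix (Fin p) (Fin p) ℝ) (k : ℕ) :
    Matrix (Fin p) (Fin p) ℝ := schur (diffSeq c) (k % 2) (k / 2)

/-- The linear functional on matrix polynomials with prescribed values on the monomials. -/
noncomputable def momentFunctional (c : ℕ → Matrix (Fin p) (Fin p) ℝ) :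
    (Matrix (Fin p) (Fin p) ℝ)[X] →+ Matrix (Fin p) (Fin p) ℝ where
  toFun f := f.sum fun i a => c i * a
  map_zero' := by simp
  map_add' f g := Polynomial.sum_add_index f g _ (by simp) (by simp [mul_add])

lemma momentFunctional_apply (c : ℕ → Matrix (Fin p) (Fin p) ℝ) {f : (Matrix (Fin p) (Fin p) ℝ)[X]}
    {N : ℕ} (hf : ∀ i, N ≤ i → f.coeff i = 0) :
    momentFunctional c f = ∑ i ∈ Finset.range N, c i * f.coeff i := by
  refine Polynomial.sum_eq_of_subset _ (by simp) fun i hi => ?_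
  by_contra h
  exact Polynomial.mem_support_iff.1 hi (hf i (by simpa using h))

lemma coeff_X_pow_mul_add (f : (Matrix (Fin p) (Fin p) ℝ)[X]) (t i : ℕ) :
    (X ^ t * f).coeff (t + i) = f.coeff i := by
  rw [add_comm, Polynomial.coeff_X_pow_mul]

lemma momentFunctional_X_pow_mul (c : ℕ → Matrix (Fin p) (Fin p) ℝ)
    {f : (Matrix (Fin p) (Fin p) ℝ)[X]} {N : ℕ} (hf : ∀ i, N ≤ i → f.coeff i = 0) (t : ℕ) :
    momentFunctional c (X ^ t * f) = ∑ i : Fin N, c (t + i) * f.coeff i := by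
  rw [momentFunctional_apply c (N := t + N), Finset.sum_range_add, Finset.sum_eq_zero, zero_add,
    Finset.sum_range]
  · simp only [coeff_X_pow_mul_add]
  · intro i hi
    rw [Polynomial.coeff_X_pow_mul', if_neg (by simpa using hi), mul_zero]
  · intro i hi
    obtain ⟨j, rfl⟩ := Nat.exists_eq_add_of_le (le_of_add_le_left hi)
    rw [coeff_X_pow_mul_add, hf _ (by omega)]

/-- The functional puts the moments to the left of the coefficients, so it is linear for right
multiplication by matrices. This is why orthogonal polynomials are always rescaled from the right.
-/
lemma momentFunctional_mul_C (c : ℕ → Matrix (Fin p) (Fin p) ℝ)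
    (f : (Matrix (Fin p) (Fin p) ℝ)[X]) (a : Matrix (Fin p) (Fin p) ℝ) :
    momentFunctional c (f * C a) = momentFunctional c f * a := by
  rw [momentFunctional_apply c (N := f.natDegree + 1), momentFunctional_apply c (N := f.natDegree + 1),
    Finset.sum_mul]
  · simp [mul_assoc]
  · intro i hi
    exact Polynomial.coeff_eq_zero_of_natDegree_lt (by omega)
  · intro i hi
    rw [Polynomial.coeff_mul_C, Polynomial.coeff_eq_zero_of_natDegree_lt (by omega), zero_mul]

lemma momentFunctional_diffSeq (c : ℕ → Matrix (Fin p) (Fin p) ℝ)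
    (f : (Matrix (Fin p) (Fin p) ℝ)[X]) (t : ℕ) :
    momentFunctional (diffSeq c) (X ^ t * f) =
      momentFunctional c (X ^ t * f) - momentFunctional c (X ^ (t + 1) * f) := by
  have hf : ∀ i, f.natDegree + 1 ≤ i → f.coeff i = 0 :=
    fun i hi => Polynomial.coeff_eq_zero_of_natDegree_lt (by omega)
  simp only [momentFunctional_X_pow_mul _ hf, ← Finset.sum_sub_distrib, diffSeq, sub_mul]
  simp only [add_right_comm]

lemma sum_blocks_apply {m : ℕ} (d : ℕ → Matrix (Fin p) (Fin p) ℝ) (t : ℕ)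
    (v : Matrix (Fin m × Fin p) (Fin p) ℝ) (x y : Fin p) :
    (∑ i : Fin m, d (t + i) * Matrix.of fun z y => v (i, z) y) x y =
      ∑ a : Fin m × Fin p, d (t + a.1) x a.2 * v a y := by
  rw [Matrix.sum_apply, Fintype.sum_prod_type]
  simp [Matrix.mul_apply]

lemma blockHankel_mul_apply {m : ℕ} (d : ℕ → Matrix (Fin p) (Fin p) ℝ) (s : ℕ)
    (v : Matrix (Fin m × Fin p) (Fin p) ℝ) (j : Fin m) (x y : Fin p) :
    (blockHankel d s m * v) (j, x) y =
      (∑ i : Fin m, d (s + j + i) * Matrix.of fun z y => v (i, z) y) x y := by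
  rw [sum_blocks_apply, Matrix.mul_apply]
  rfl

/-- Take `X^m - ∑ X^i v_i` with `v = H⁻¹ h`. The orthogonality relations are the block rows of `H v
= h`, and pairing with the next power gives the corner block minus `hᵀ v`. -/
lemma exists_orthogonal_polynomial {d : ℕ → Matrix (Fin p) (Fin p) ℝ} (hd : ∀ k, (d k).IsSymm)
    {s m : ℕ} (hH : (blockHankel d s m).PosDef) :
    ∃ P : (Matrix (Fin p) (Fin p) ℝ)[X], P.coeff m = 1 ∧ (∀ i, m < i → P.coeff i = 0) ∧
      (∀ j < m, momentFunctional d (X ^ (s + j) * P) = 0) ∧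
      momentFunctional d (X ^ (s + m) * P) = schur d s m := by
  set v := (blockHankel d s m)⁻¹ * blockColumn d (s + m) m with hv
  have hHv : blockHankel d s m * v = blockColumn d (s + m) m := by
    rw [hv, Matrix.mul_nonsing_inv_cancel_left _ _ ((Matrix.isUnit_iff_isUnit_det _).1 hH.isUnit)]
  set q : (Matrix (Fin p) (Fin p) ℝ)[X] :=
    ∑ i : Fin m, monomial (i : ℕ) (Matrix.of fun z y => v (i, z) y) with hq
  have hqc : ∀ i : Fin m, q.coeff i = Matrix.of fun z y => v (i, z) y := by
    intro i
    rw [hq, Polynomial.finsetSum_coeff, Finset.sum_eq_single i]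
    · simp
    · intro b _ hb
      rw [Polynomial.coeff_monomial, if_neg (fun h => hb (Fin.ext h))]
    · simp
  have hq0 : ∀ i, m ≤ i → q.coeff i = 0 := by
    intro i hi
    rw [hq, Polynomial.finsetSum_coeff]
    refine Finset.sum_eq_zero fun b _ => ?_
    rw [Polynomial.coeff_monomial, if_neg (by omega)]
  have hL : ∀ t, momentFunctional d (X ^ t * (X ^ m - q)) =
      d (t + m) - ∑ i : Fin m, d (t + i) * Matrix.of fun z y => v (i, z) y := by
    intro t
    rw [mul_sub, map_sub, momentFunctional_X_pow_mul d hq0, ← pow_add]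
    simp only [hqc]
    congr 1
    rw [momentFunctional_apply d (N := t + m + 1), Finset.sum_eq_single (t + m)]
    · simp
    · intro b _ hb
      rw [Polynomial.coeff_X_pow, if_neg hb, mul_zero]
    · simp
    · intro i hi
      rw [Polynomial.coeff_X_pow, if_neg (by omega)]
  refine ⟨X ^ m - q, ?_, ?_, ?_, ?_⟩
  · rw [Polynomial.coeff_sub, hq0 m le_rfl]; simp
  · intro i hi
    rw [Polynomial.coeff_sub, hq0 i hi.le, Polynomial.coeff_X_pow, if_neg (by omega), sub_zero]
  · intro j hj
    rw [hL, sub_eq_zero]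
    ext x y
    rw [← blockHankel_mul_apply d s v ⟨j, hj⟩, hHv]
    simp [blockColumn, add_right_comm]
  · rw [hL, schur, Matrix.mul_assoc, ← hv, two_mul, ← add_assoc]
    congr 1
    ext x y
    rw [sum_blocks_apply, Matrix.mul_apply]
    simp [blockColumn, (hd _).apply]

/-- The coefficients form a block vector in the kernel of the invertible Hankel matrix. -/
lemma eq_zero_of_orthogonal {d : ℕ → Matrix (Fin p) (Fin p) ℝ} {s m : ℕ}
    (hH : (blockHankel d s m).PosDef) {f : (Matrix (Fin p) (Fin p) ℝ)[X]}
    (hf : ∀ i, m ≤ i → f.coeff i = 0)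
    (h : ∀ j < m, momentFunctional d (X ^ (s + j) * f) = 0) : f = 0 := by
  set v : Matrix (Fin m × Fin p) (Fin p) ℝ := Matrix.of fun a y => f.coeff a.1 a.2 y with hv
  have hHv : blockHankel d s m * v = 0 := by
    ext ⟨j, x⟩ y
    rw [blockHankel_mul_apply]
    have := h j j.2
    rw [momentFunctional_X_pow_mul d hf] at this
    exact congrFun (congrFun this x) y
  have hv0 : v = 0 := by
    have := congrArg ((blockHankel d s m)⁻¹ * ·) hHv
    simpa [Matrix.nonsing_inv_mul_cancel_left _ _
      ((Matrix.isUnit_iff_isUnit_det _).1 hH.isUnit)] using this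
  ext i x y
  by_cases hi : i < m
  · simpa [hv] using congrFun (congrFun hv0 (⟨i, hi⟩, x)) y
  · rw [hf i (by omega)]; rfl

/-- By uniqueness `f` is the monic orthogonal polynomial times its coefficient of index `m`. That
coefficient may be singular or zero. -/
lemma momentFunctional_of_orthogonal {d : ℕ → Matrix (Fin p) (Fin p) ℝ} (hd : ∀ k, (d k).IsSymm)
    {s m : ℕ} (hH : (blockHankel d s m).PosDef) {f : (Matrix (Fin p) (Fin p) ℝ)[X]}
    (hf : ∀ i, m < i → f.coeff i = 0)
    (h : ∀ j < m, momentFunctional d (X ^ (s + j) * f) = 0) :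
    momentFunctional d (X ^ (s + m) * f) = schur d s m * f.coeff m := by
  obtain ⟨P, hP1, hP2, hP3, hP4⟩ := exists_orthogonal_polynomial hd hH
  have key : f - P * C (f.coeff m) = 0 := by
    refine eq_zero_of_orthogonal hH (fun i hi => ?_) fun j hj => ?_
    · rw [Polynomial.coeff_sub, Polynomial.coeff_mul_C]
      rcases hi.eq_or_lt with rfl | hi
      · rw [hP1, one_mul, sub_self]
      · rw [hP2 i hi, hf i hi, zero_mul, sub_self]
    · rw [mul_sub, map_sub, h j hj, ← mul_assoc, momentFunctional_mul_C, hP3 j hj, zero_mul,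
        sub_self]
  rw [sub_eq_zero] at key
  conv_lhs => rw [key]
  rw [← mul_assoc, momentFunctional_mul_C, hP4]

/-- Together the two relations say `(A + B) G = B`; eliminating `G`, the unknown leading coefficient
in the applications, leaves the parallel sum. -/
lemma eq_parallel_of_mul_eq {ι : Type*} [Fintype ι] [DecidableEq ι] {A B G D : Matrix ι ι ℝ}
    (hAB : (A + B).PosDef) (h1 : D = A * G) (h2 : B * (G - 1) = -(A * G)) :
    D = A * (A + B)⁻¹ * B := by
  have h3 : (A + B) * G = B := by
    rw [mul_sub, mul_one] at h2
    rw [add_mul, ← sub_eq_zero]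
    have := sub_eq_zero.2 h2
    rw [← this]; abel
  have h4 : (A + B)⁻¹ * B = (A + B)⁻¹ * ((A + B) * G) := by rw [h3]
  rw [h1, Matrix.mul_assoc, h4, Matrix.nonsing_inv_mul_cancel_left _ _
      ((Matrix.isUnit_iff_isUnit_det _).1 hAB.isUnit)]

/-- Let `R` and `T` be monic orthogonal of degree `l + 1` for the weights `x` and `1 - x`. The
polynomial `W = xR + (1-x)T` is orthogonal for the weight `1`, and `R - T` is orthogonal for
`x(1-x)` because `x(R - T) = W - T`. Their top coefficients are `G` and `G - 1`, so evaluating both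
in two ways gives the hypotheses of `eq_parallel_of_mul_eq`. -/
lemma gap_parallel_even {c : ℕ → Matrix (Fin p) (Fin p) ℝ} (hc : ∀ k, (c k).IsSymm) {l : ℕ}
    (h1 : (blockHankel c 1 (l + 1)).PosDef) (h2 : (blockHankel (diffSeq c) 0 (l + 1)).PosDef)
    (h3 : (blockHankel c 0 (l + 1)).PosDef) (h4 : (blockHankel (diffSeq c) 1 l).PosDef)
    (hAB : (schur c 0 (l + 1) + schur (diffSeq c) 1 l).PosDef) :
    schur c 1 (l + 1) + schur (diffSeq c) 0 (l + 1) =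
      schur c 0 (l + 1) * (schur c 0 (l + 1) + schur (diffSeq c) 1 l)⁻¹ * schur (diffSeq c) 1 l := by
  obtain ⟨R, hR1, hR2, hR3, hR4⟩ := exists_orthogonal_polynomial hc h1
  obtain ⟨T, hT1, hT2, hT3, hT4⟩ := exists_orthogonal_polynomial (diffSeq_isSymm hc) h2
  simp only [zero_add] at hT3 hT4
  set W := X * R + T - X * T with hW
  have hWc : ∀ i, W.coeff (i + 1) = R.coeff i + T.coeff (i + 1) - T.coeff i := by
    intro i
    rw [hW, Polynomial.coeff_sub, Polynomial.coeff_add, Polynomial.coeff_X_mul,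
      Polynomial.coeff_X_mul]
  have hWL : ∀ j, momentFunctional c (X ^ j * W) =
      momentFunctional c (X ^ (1 + j) * R) + momentFunctional (diffSeq c) (X ^ j * T) := by
    intro j
    rw [momentFunctional_diffSeq, hW, mul_sub, mul_add, map_sub, map_add, ← mul_assoc, ← mul_assoc,
      ← pow_succ, add_comm 1 j, add_sub_assoc]
  have hW0 : ∀ j < l + 1, momentFunctional c (X ^ j * W) = 0 := by
    intro j hj
    rw [hWL, hR3 j hj, hT3 j hj, add_zero]
  -- The two terms of degree `l + 2` in `W` cancel since `R` and `T` are both monic.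
  have hWA := momentFunctional_of_orthogonal hc h3 (f := W) (fun i hi => by
    obtain ⟨i, rfl⟩ := Nat.exists_eq_add_of_lt hi
    rw [show l + 1 + i + 1 = (l + 1 + i) + 1 from rfl, hWc, hT2 _ (by omega), add_zero]
    rcases Nat.eq_zero_or_pos i with rfl | hi
    · rw [add_zero, hR1, hT1, sub_self]
    · rw [hR2 _ (by omega), hT2 _ (by omega), sub_self]) (fun j hj => by
    rw [zero_add, hW0 j hj])
  have hXF : ∀ j, X ^ (1 + j) * (R - T) = X ^ j * W - X ^ j * T := by
    intro j
    rw [hW, add_comm 1 j, pow_succ, mul_assoc, ← mul_sub]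
    congr 1
    rw [mul_sub]; abel
  have hFL : ∀ j, momentFunctional (diffSeq c) (X ^ (1 + j) * (R - T)) =
      momentFunctional c (X ^ j * W) - momentFunctional c (X ^ (j + 1) * W) -
        momentFunctional (diffSeq c) (X ^ j * T) := by
    intro j
    rw [hXF, map_sub, momentFunctional_diffSeq c W]
  have hFB := momentFunctional_of_orthogonal (diffSeq_isSymm hc) h4 (f := R - T) (fun i hi => by
    rw [Polynomial.coeff_sub]
    rcases Nat.lt_or_ge (l + 1) i with hi' | hi'
    · rw [hR2 i hi', hT2 i hi', sub_self]
    · obtain rfl : i = l + 1 := by omega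
      rw [hR1, hT1, sub_self]) (fun j hj => by
    rw [hFL, hW0 j (by omega), hW0 (j + 1) (by omega), hT3 j (by omega)]; simp)
  rw [zero_add] at hWA
  refine eq_parallel_of_mul_eq (G := W.coeff (l + 1)) hAB ?_ ?_
  · rw [← hWA, hWL, hR4, hT4]
  · have : (R - T).coeff l = W.coeff (l + 1) - 1 := by
      rw [hWc, hT1, Polynomial.coeff_sub]; abel
    rw [← this, ← hFB, hFL, hWA, hW0 l (by omega), hT3 l (by omega)]; simp

/-- Same scheme with `P` of degree `m + 1` for the weight `1` and `Q` of degree `m` for `x(1-x)`: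
now `W = P + (1-x)Q` is orthogonal for `x`, and `W - Q = P - xQ` is orthogonal for `1 - x`. -/
lemma gap_parallel_odd {c : ℕ → Matrix (Fin p) (Fin p) ℝ} (hc : ∀ k, (c k).IsSymm) {m : ℕ}
    (h1 : (blockHankel c 0 (m + 1)).PosDef) (h2 : (blockHankel (diffSeq c) 1 m).PosDef)
    (h3 : (blockHankel c 1 m).PosDef) (h4 : (blockHankel (diffSeq c) 0 m).PosDef)
    (hAB : (schur c 1 m + schur (diffSeq c) 0 m).PosDef) :
    schur c 0 (m + 1) + schur (diffSeq c) 1 m =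
      schur c 1 m * (schur c 1 m + schur (diffSeq c) 0 m)⁻¹ * schur (diffSeq c) 0 m := by
  obtain ⟨P, hP1, hP2, hP3, hP4⟩ := exists_orthogonal_polynomial hc h1
  obtain ⟨Q, hQ1, hQ2, hQ3, hQ4⟩ := exists_orthogonal_polynomial (diffSeq_isSymm hc) h2
  simp only [zero_add] at hP3 hP4
  set W := P + Q - X * Q with hW
  have hWc : ∀ i, W.coeff (i + 1) = P.coeff (i + 1) + Q.coeff (i + 1) - Q.coeff i := by
    intro i
    rw [hW, Polynomial.coeff_sub, Polynomial.coeff_add, Polynomial.coeff_X_mul]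
  have hWL : ∀ j, momentFunctional c (X ^ (1 + j) * W) =
      momentFunctional c (X ^ (j + 1) * P) + momentFunctional (diffSeq c) (X ^ (1 + j) * Q) := by
    intro j
    rw [momentFunctional_diffSeq, hW, mul_sub, mul_add, map_sub, map_add, ← mul_assoc,
      ← pow_succ, add_comm 1 j, add_sub_assoc]
  have hWA := momentFunctional_of_orthogonal hc h3 (f := W) (fun i hi => by
    obtain ⟨i, rfl⟩ := Nat.exists_eq_add_of_lt hi
    rw [hWc, hQ2 _ (by omega), add_zero]
    rcases Nat.eq_zero_or_pos i with rfl | hi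
    · rw [add_zero, hP1, hQ1, sub_self]
    · rw [hP2 _ (by omega), hQ2 _ (by omega), sub_self]) (fun j hj => by
    rw [hWL, hP3 _ (by omega), hQ3 j hj, add_zero])
  have hWF : W - Q = P - X * Q := by rw [hW]; abel
  have hFL : ∀ j, momentFunctional (diffSeq c) (X ^ (0 + j) * (W - Q)) =
      momentFunctional c (X ^ j * P) - momentFunctional c (X ^ (j + 1) * P) -
        momentFunctional (diffSeq c) (X ^ (1 + j) * Q) := by
    intro j
    rw [hWF, zero_add, mul_sub, map_sub, ← mul_assoc, ← pow_succ, momentFunctional_diffSeq c P,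
      add_comm 1 j]
  have hFB := momentFunctional_of_orthogonal (diffSeq_isSymm hc) h4 (f := W - Q) (fun i hi => by
    obtain ⟨i, rfl⟩ := Nat.exists_eq_add_of_lt hi
    rw [Polynomial.coeff_sub, hWc, hQ2 (m + i + 1) (by omega), add_zero, sub_zero]
    rcases Nat.eq_zero_or_pos i with rfl | hi
    · rw [add_zero, hP1, hQ1, sub_self]
    · rw [hP2 _ (by omega), hQ2 _ (by omega), sub_self]) (fun j hj => by
    rw [hFL, hP3 j (by omega), hP3 (j + 1) (by omega), hQ3 j (by omega)]; simp)
  have hWAB : momentFunctional c (X ^ (1 + m) * W) = schur c 0 (m + 1) + schur (diffSeq c) 1 m := by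
    rw [hWL, hP4, hQ4]
  refine eq_parallel_of_mul_eq (G := W.coeff m) hAB ?_ ?_
  · rw [← hWA, hWAB]
  · have : (W - Q).coeff m = W.coeff m - 1 := by
      rw [Polynomial.coeff_sub, hQ1]
    rw [← this, ← hFB, hFL, ← hWA, hWAB, hP3 m (by omega), hP4, hQ4]
    abel

/-- The width of the range of the next moment is the parallel sum of the two gaps. -/
theorem gap_parallel {c : ℕ → Matrix (Fin p) (Fin p) ℝ} (hc : ∀ k, (c k).IsSymm) {k : ℕ}
    (hA : ∀ i < k + 2, (lowerGap c i).PosDef) (hB : ∀ i < k + 1, (upperGap c i).PosDef) :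
    lowerGap c (k + 2) + upperGap c (k + 1) =
      lowerGap c (k + 1) * (lowerGap c (k + 1) + upperGap c k)⁻¹ * upperGap c k := by
  have hA' := (blockHankel_posDef_iff hc (k + 2)).2 hA
  have hB' := (blockHankel_posDef_iff (diffSeq_isSymm hc) (k + 1)).2 hB
  have hAB := (hA (k + 1) (by omega)).add (hB k (by omega))
  unfold lowerGap upperGap at *
  rcases Nat.even_or_odd' k with ⟨m, rfl | rfl⟩
  · rw [show (2 * m + 2) % 2 = 0 by omega, show (2 * m + 2) / 2 = m + 1 by omega,
      show (2 * m + 1) % 2 = 1 by omega, show (2 * m + 1) / 2 = m by omega,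
      show (2 * m) % 2 = 0 by omega, show (2 * m) / 2 = m by omega] at *
    exact gap_parallel_odd hc (hA' _ (by omega) _ (by omega)) (hB' _ (by omega) _ (by omega))
      (hA' _ (by omega) _ (by omega)) (hB' _ (by omega) _ (by omega)) hAB
  · rw [show (2 * m + 1 + 2) % 2 = 1 by omega, show (2 * m + 1 + 2) / 2 = m + 1 by omega,
      show (2 * m + 1 + 1) % 2 = 0 by omega, show (2 * m + 1 + 1) / 2 = m + 1 by omega,
      show (2 * m + 1) % 2 = 1 by omega, show (2 * m + 1) / 2 = m by omega] at *
    exact gap_parallel_even hc (hA' _ (by omega) _ (by omega)) (hB' _ (by omega) _ (by omega))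
      (hA' _ (by omega) _ (by omega)) (hB' _ (by omega) _ (by omega)) hAB

/-- The product is not visibly symmetric, but its inverse is `B⁻¹ + A⁻¹`. -/
lemma posDef_parallel {ι : Type*} [Fintype ι] [DecidableEq ι] {A B : Matrix ι ι ℝ}
    (hA : A.PosDef) (hB : B.PosDef) : (A * (A + B)⁻¹ * B).PosDef := by
  have hA' := (Matrix.isUnit_iff_isUnit_det _).1 hA.isUnit
  have hB' := (Matrix.isUnit_iff_isUnit_det _).1 hB.isUnit
  rw [← Matrix.posDef_inv_iff]
  have : (A * (A + B)⁻¹ * B)⁻¹ = B⁻¹ + A⁻¹ := by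
    rw [Matrix.mul_inv_rev, Matrix.mul_inv_rev, Matrix.nonsing_inv_nonsing_inv _
      ((Matrix.isUnit_iff_isUnit_det _).1 (hA.add hB).isUnit), add_mul, mul_add,
      Matrix.mul_nonsing_inv _ hA', Matrix.nonsing_inv_mul_cancel_left _ _ hB', mul_one]
  rw [this]
  exact hB.inv.add hA.inv

end Hankel

/-! ### Moments of matrix measures have positive semidefinite Hankel matrices. -/

section MomentsNecessary

open Filter Topology VectorMeasure

variable {p : ℕ}

/-- The Jordan decomposition bounds the variation by two finite measures. Finiteness makes constants
integrable, hence available as dominating functions. -/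
instance isFiniteMeasure_variation_signedMeasure {α : Type*} [MeasurableSpace α]
    (s : SignedMeasure α) : IsFiniteMeasure s.variation := by
  have h : s.variation ≤ s.toJordanDecomposition.posPart + s.toJordanDecomposition.negPart := by
    conv_lhs => rw [← s.toSignedMeasure_toJordanDecomposition, JordanDecomposition.toSignedMeasure]
    refine variation_sub_le.trans ?_
    rw [Measure.variation_toSignedMeasure, Measure.variation_toSignedMeasure]
  exact isFiniteMeasure_of_le _ h

/-- The block Hankel matrix of a finite sum of power moments with nonnegative weights. -/
lemma blockHankel_posSemidef_of_sum {ι : Type*} (F : Finset ι) {t : ι → ℝ} (ht : ∀ l ∈ F, 0 ≤ t l)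
    {W : ι → Matrix (Fin p) (Fin p) ℝ} (hW : ∀ l ∈ F, (W l).PosSemidef) (s m : ℕ) :
    (blockHankel (fun k => ∑ l ∈ F, t l ^ k • W l) s m).PosSemidef := by
  -- `E l` stacks the blocks `t_l^i I`, so each atom contributes the congruence `t_l^s E W Eᴴ`.
  set E : ι → Matrix (Fin m × Fin p) (Fin p) ℝ := fun l =>
    Matrix.of fun a b => if a.2 = b then t l ^ (a.1 : ℕ) else 0 with hE
  have : blockHankel (fun k => ∑ l ∈ F, t l ^ k • W l) s m =
      ∑ l ∈ F, t l ^ s • (E l * W l * (E l).conjTranspose) := by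
    ext ⟨i, a⟩ ⟨j, b⟩
    simp only [blockHankel, Matrix.of_apply, Matrix.sum_apply, Matrix.smul_apply, smul_eq_mul]
    refine Finset.sum_congr rfl fun l _ => ?_
    simp only [Matrix.mul_apply, hE, Matrix.of_apply, ite_mul, zero_mul, Finset.sum_ite_eq,
      Finset.mem_univ, if_true, Matrix.conjTranspose_apply, star_trivial, mul_ite, mul_zero]
    ring
  rw [this]
  exact Matrix.posSemidef_sum _ fun l hl =>
    ((hW l hl).mul_mul_conjTranspose_same _).smul (pow_nonneg (ht l hl) s)

lemma posSemidef_of_tendsto {ι : Type*} [Fintype ι] {M : ℕ → Matrix ι ι ℝ} {A : Matrix ι ι ℝ}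
    (hM : ∀ N, (M N).PosSemidef) (h : ∀ i j, Tendsto (fun N => M N i j) atTop (𝓝 (A i j))) :
    A.PosSemidef := by
  refine Matrix.PosSemidef.of_dotProduct_mulVec_nonneg ?_ fun x => ?_
  · ext i j
    rw [Matrix.conjTranspose_apply, star_trivial]
    refine tendsto_nhds_unique (h j i) ((h i j).congr fun N => ?_)
    simpa using (hM N).isHermitian.apply j i
  · refine ge_of_tendsto' (f := fun N => star x ⬝ᵥ ((M N).mulVec x)) (x := atTop) ?_
      fun N => (hM N).dotProduct_mulVec_nonneg x
    simp only [dotProduct, Matrix.mulVec]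
    exact tendsto_finsetSum _ fun i _ => (tendsto_const_nhds.mul
      (tendsto_finsetSum _ fun j _ => (h i j).mul_const _))

/-- The cells of the regular partition of the unit interval. -/
def cell (N l : ℕ) : Set (Set.Icc (0 : ℝ) 1) := {x | ⌊((N : ℝ) + 1) * x⌋₊ = l}

lemma measurableSet_cell (N l : ℕ) : MeasurableSet (cell N l) :=
  (Nat.measurable_floor.comp (by fun_prop : Measurable fun x : Set.Icc (0 : ℝ) 1 =>
    ((N : ℝ) + 1) * (x : ℝ))) (measurableSet_singleton l)

/-- Riemann sums converge to the power moments of a signed measure. -/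
lemma tendsto_riemann_sum (s : SignedMeasure (Set.Icc (0 : ℝ) 1)) (k : ℕ) :
    Tendsto (fun N : ℕ => ∑ l ∈ Finset.range (N + 2), ((l : ℝ) / (N + 1)) ^ k * s (cell N l)) atTop
      (𝓝 (∫ᵛ x, (x : ℝ) ^ k ∂•s)) := by
  -- The point `x = 1` lies in the extra cell `N + 1`, which is why `N + 2` cells are needed.
  have hfl : ∀ (N : ℕ) (x : Set.Icc (0 : ℝ) 1), ⌊((N : ℝ) + 1) * x⌋₊ ∈ Finset.range (N + 2) := by
    intro N x
    rw [Finset.mem_range, Nat.floor_lt (mul_nonneg (by positivity) x.2.1)]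
    have := x.2.2
    push_cast
    nlinarith
  have h1 : ∀ N : ℕ, ∑ l ∈ Finset.range (N + 2), ((l : ℝ) / (N + 1)) ^ k * s (cell N l) =
      ∫ᵛ x, ((⌊((N : ℝ) + 1) * x⌋₊ : ℝ) / (N + 1)) ^ k ∂•s := by
    intro N
    have h2 : (fun x : Set.Icc (0 : ℝ) 1 => ((⌊((N : ℝ) + 1) * x⌋₊ : ℝ) / (N + 1)) ^ k) =
        fun x => ∑ l ∈ Finset.range (N + 2),
          (cell N l).indicator (fun _ => ((l : ℝ) / (N + 1)) ^ k) x := by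
      funext x
      rw [Finset.sum_eq_single_of_mem _ (hfl N x)]
      · rw [Set.indicator_of_mem (by simp [cell])]
      · intro b _ hb
        exact Set.indicator_of_notMem (fun h => hb h.symm) _
    rw [h2, VectorMeasure.integral_finsetSum]
    · refine Finset.sum_congr rfl fun l _ => ?_
      rw [VectorMeasure.integral_indicator (measurableSet_cell N l), VectorMeasure.integral_const,
        VectorMeasure.restrict_apply _ (measurableSet_cell N l) MeasurableSet.univ]
      simp
    · intro l _
      exact (integrable_const _).indicator (measurableSet_cell N l)
  simp only [h1]
  refine VectorMeasure.tendsto_integral_of_dominated_convergence (fun _ => 1) (fun N => ?_)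
    (integrable_const _) (fun N => Filter.Eventually.of_forall fun x => ?_)
    (Filter.Eventually.of_forall fun x => ?_)
  · refine Measurable.aestronglyMeasurable ?_
    have : Measurable fun x : Set.Icc (0 : ℝ) 1 => (⌊((N : ℝ) + 1) * x⌋₊ : ℝ) :=
      measurable_from_nat.comp (Nat.measurable_floor.comp (by fun_prop))
    fun_prop
  · have h0 : (0 : ℝ) ≤ ⌊((N : ℝ) + 1) * x⌋₊ / (N + 1) := by positivity
    rw [Real.norm_of_nonneg (pow_nonneg h0 k)]
    refine pow_le_one₀ h0 ?_
    rw [div_le_one (by positivity)]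
    refine (Nat.floor_le (mul_nonneg (by positivity) x.2.1)).trans ?_
    have := x.2.2
    have : (0 : ℝ) ≤ N := by positivity
    nlinarith [x.2.2]
  · refine Tendsto.pow ?_ k
    have h := tendsto_nat_floor_mul_div_atTop (R := ℝ) (a := (x : ℝ)) x.2.1
    have h3 := h.comp (tendsto_natCast_atTop_atTop.comp (tendsto_add_atTop_nat 1))
    refine h3.congr fun N => ?_
    simp [mul_comm]

lemma tendsto_moment (μ : MatrixMeasure p) (k : ℕ) (i j : Fin p) :
    Tendsto (fun N : ℕ => (∑ l ∈ Finset.range (N + 2), ((l : ℝ) / (N + 1)) ^ k •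
      Matrix.of fun i j => μ.entry i j (cell N l)) i j) atTop (𝓝 (μ.moment k i j)) := by
  simp only [Matrix.sum_apply, Matrix.smul_apply, Matrix.of_apply, smul_eq_mul]
  exact tendsto_riemann_sum _ k

/-- Nonnegativity of a matrix measure is only given set by set. Riemann sums use just its values on
cells, and the semidefinite cone is closed under entrywise limits. -/
lemma blockHankel_moment_posSemidef (μ : MatrixMeasure p) (s m : ℕ) :
    (blockHankel μ.moment s m).PosSemidef :=
  posSemidef_of_tendsto (fun N => blockHankel_posSemidef_of_sum (Finset.range (N + 2))
    (t := fun l => (l : ℝ) / (N + 1)) (fun l _ => by positivity)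
    (fun l _ => μ.posSemidef (cell N l) (measurableSet_cell N l)) s m)
    fun a b => tendsto_moment μ _ _ _

lemma blockHankel_diffSeq_moment_posSemidef (μ : MatrixMeasure p) (s m : ℕ) :
    (blockHankel (diffSeq μ.moment) s m).PosSemidef := by
  refine posSemidef_of_tendsto (fun N => blockHankel_posSemidef_of_sum (Finset.range (N + 2))
    (t := fun l => (l : ℝ) / (N + 1)) (fun l _ => by positivity)
    (W := fun l => (1 - (l : ℝ) / (N + 1)) • Matrix.of fun i j => μ.entry i j (cell N l))
    (fun l hl => (μ.posSemidef (cell N l) (measurableSet_cell N l)).smul ?_) s m)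
    fun a b => ?_
  · rw [sub_nonneg, div_le_one (by positivity)]
    exact_mod_cast Nat.lt_succ_iff.1 (Finset.mem_range.1 hl)
  · refine ((tendsto_moment μ _ _ _).sub (tendsto_moment μ _ _ _)).congr fun N => ?_
    simp only [blockHankel, Matrix.of_apply, ← Matrix.sub_apply, ← Finset.sum_sub_distrib]
    refine congrFun (congrFun ?_ _) _
    refine Finset.sum_congr rfl fun l _ => ?_
    rw [smul_smul, ← sub_smul]
    congr 1
    ring

lemma moment_zero (μ : MatrixMeasure p) : μ.moment 0 = 1 := by
  rw [← μ.normalized]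
  ext i j
  simp [MatrixMeasure.moment]

end MomentsNecessary

/-! ### Representing measures for sequences with positive definite gaps. -/

section MomentsSufficient

variable {p : ℕ}

/-- The matrix measure with finitely many atoms of rank one. -/
noncomputable def atomicMeasure {ι : Type*} [Fintype ι] (t : ι → Set.Icc (0 : ℝ) 1)
    (Y : Matrix ι (Fin p) ℝ) (hY : Y.transpose * Y = 1) : MatrixMeasure p where
  entry i j := ∑ l, VectorMeasure.dirac (t l) (Y l i * Y l j)
  posSemidef A hA := by
    classical
    have : (Matrix.of fun i j => (∑ l, VectorMeasure.dirac (t l) (Y l i * Y l j)) A) =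
        ∑ l, if t l ∈ A then Matrix.vecMulVec (Y l) (star (Y l)) else 0 := by
      ext i j
      rw [Matrix.of_apply, Matrix.sum_apply, FunLike.coe_sum, Finset.sum_apply]
      refine Finset.sum_congr rfl fun l _ => ?_
      by_cases h : t l ∈ A <;> simp [h, hA, Matrix.vecMulVec_apply]
    rw [this]
    refine Matrix.posSemidef_sum _ fun l _ => ?_
    split_ifs
    · exact Matrix.posSemidef_vecMulVec_self_star _
    · exact Matrix.PosSemidef.zero
  normalized := by
    rw [← hY]
    ext i j
    rw [Matrix.of_apply, FunLike.coe_sum, Finset.sum_apply, Matrix.mul_apply]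
    simp

lemma atomicMeasure_moment {ι : Type*} [Fintype ι] (t : ι → Set.Icc (0 : ℝ) 1)
    (Y : Matrix ι (Fin p) ℝ) (hY : Y.transpose * Y = 1) (k : ℕ) (i j : Fin p) :
    (atomicMeasure t Y hY).moment k i j = ∑ l, (t l : ℝ) ^ k * (Y l i * Y l j) := by
  simp only [MatrixMeasure.moment, Matrix.of_apply, atomicMeasure]
  rw [VectorMeasure.integral_finsetSum_vectorMeasure]
  · simp
  · intro l _
    unfold VectorMeasure.Integrable
    rw [VectorMeasure.variation_dirac]
    exact (integrable_dirac (by simp)).smul_measure (by finiteness)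

/-- A symmetric matrix `T` with `0 ≤ T ≤ 1` gives a matrix measure with the moments
`X₀ᵀ T ^ k X₀`. -/
lemma exists_measure_of_contraction {ι : Type*} [Fintype ι] [DecidableEq ι] {T : Matrix ι ι ℝ}
    (h0 : T.PosSemidef) (h1 : (1 - T).PosSemidef) (Z : Matrix ι (Fin p) ℝ)
    (hZ : Z.transpose * Z = 1) :
    ∃ μ : MatrixMeasure p, ∀ k, μ.moment k = Z.transpose * T ^ k * Z := by
  set Q : Matrix ι ι ℝ := (h0.isHermitian.eigenvectorUnitary : Matrix ι ι ℝ) with hQ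
  set ev := h0.isHermitian.eigenvalues with hev
  have hQQ : Q.transpose * Q = 1 := by
    have := Unitary.coe_star_mul_self h0.isHermitian.eigenvectorUnitary
    rwa [Matrix.star_eq_conjTranspose, Matrix.conjTranspose_eq_transpose_of_trivial] at this
  have hQQ' : Q * Q.transpose = 1 := mul_eq_one_comm.1 hQQ
  have hT : T = Q * Matrix.diagonal ev * Q.transpose := by
    have := h0.isHermitian.spectral_theorem
    rw [Unitary.conjStarAlgAut_apply, Matrix.star_eq_conjTranspose,
      Matrix.conjTranspose_eq_transpose_of_trivial] at this
    simpa using this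
  have hTk : ∀ k, T ^ k = Q * Matrix.diagonal (ev ^ k) * Q.transpose := by
    intro k
    induction k with
    | zero => simp [hQQ']
    | succ k ih =>
      rw [pow_succ, ih]
      conv_lhs => arg 2; rw [hT]
      rw [pow_succ, show ev ^ k * ev = fun i => (ev ^ k) i * ev i from rfl,
        ← Matrix.diagonal_mul_diagonal]
      simp only [Matrix.mul_assoc]
      rw [← Matrix.mul_assoc Q.transpose Q, hQQ, one_mul]
  have hev1 : ∀ l, ev l ≤ 1 := by
    intro l
    have := (h1.conjTranspose_mul_mul_same Q).diag_nonneg (i := l)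
    rw [Matrix.conjTranspose_eq_transpose_of_trivial, mul_sub, mul_one, sub_mul, hQQ, hT] at this
    simp only [Matrix.mul_assoc] at this
    rw [hQQ, mul_one, ← Matrix.mul_assoc, hQQ, one_mul] at this
    simpa using this
  -- The atoms sit at the eigenvalues of `T`, with rank one weights formed from the rows of `Qᵀ Z`.
  have hY : (Q.transpose * Z).transpose * (Q.transpose * Z) = 1 := by
    rw [Matrix.transpose_mul, Matrix.transpose_transpose, Matrix.mul_assoc, ← Matrix.mul_assoc Q,
      hQQ', Matrix.one_mul, hZ]
  refine ⟨atomicMeasure (fun l => ⟨ev l, h0.eigenvalues_nonneg l, hev1 l⟩) _ hY, fun k => ?_⟩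
  ext i j
  rw [atomicMeasure_moment, hTk]
  have : Z.transpose * (Q * Matrix.diagonal (ev ^ k) * Q.transpose) * Z =
      (Q.transpose * Z).transpose * (Matrix.diagonal (ev ^ k) * (Q.transpose * Z)) := by
    rw [Matrix.transpose_mul, Matrix.transpose_transpose]
    simp only [Matrix.mul_assoc]
  rw [this, Matrix.mul_apply]
  refine Finset.sum_congr rfl fun l _ => ?_
  rw [Matrix.diagonal_mul, Matrix.transpose_apply, Pi.pow_apply]
  ring

/-- The inclusion of the `j`-th block. -/
def blockUnit (m p : ℕ) (j : Fin m) : Matrix (Fin m × Fin p) (Fin p) ℝ :=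
  Matrix.of fun a b => if a = (j, b) then 1 else 0

lemma mul_blockUnit_apply {m : ℕ} {κ : Type*} (A : Matrix κ (Fin m × Fin p) ℝ) (j : Fin m) (a : κ)
    (b : Fin p) : (A * blockUnit m p j) a b = A a (j, b) := by
  simp [Matrix.mul_apply, blockUnit]

lemma blockUnit_transpose_mul_apply {m : ℕ} {κ : Type*} (A : Matrix (Fin m × Fin p) κ ℝ)
    (j : Fin m) (a : Fin p) (b : κ) : ((blockUnit m p j).transpose * A) a b = A (j, a) b := by
  simp [Matrix.mul_apply, blockUnit]

/-- For the inner product on block vectors given by `H0`, the form `H1` is multiplication by `x`; in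
orthonormal coordinates it becomes `T = H0^{-1/2} H1 H0^{-1/2}`. Semidefiniteness of `H1` and `H0 -
H1` means `0 ≤ T ≤ 1`, and the moments are those of `T` at the block vector of the constant
polynomial. -/
lemma exists_measure_of_hankel {c : ℕ → Matrix (Fin p) (Fin p) ℝ}
    (hc0 : c 0 = 1) {m : ℕ} (h0 : (blockHankel c 0 (m + 1)).PosDef)
    (h1 : (blockHankel c 1 (m + 1)).PosSemidef)
    (h2 : (blockHankel (diffSeq c) 0 (m + 1)).PosSemidef) :
    ∃ μ : MatrixMeasure p, ∀ k ≤ 2 * m + 1, μ.moment k = c k := by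
  set H0 := blockHankel c 0 (m + 1) with hH0
  set H1 := blockHankel c 1 (m + 1) with hH1
  have hd : blockHankel (diffSeq c) 0 (m + 1) = H0 - H1 := by
    ext a b
    simp only [hH0, hH1, blockHankel, diffSeq, Matrix.of_apply, Matrix.sub_apply]
    rw [show 0 + (a.1 : ℕ) + b.1 + 1 = 1 + a.1 + b.1 by ring]
  rw [hd] at h2
  set R := CFC.sqrt H0 with hR
  have hRR : R * R = H0 := CFC.sqrt_mul_sqrt_self H0 h0.posSemidef.nonneg
  have hRdet : IsUnit R.det := by
    have : R.det * R.det ≠ 0 := by rw [← Matrix.det_mul, hRR]; exact h0.det_pos.ne'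
    exact isUnit_iff_ne_zero.2 (left_ne_zero_of_mul this)
  have hRs : R.transpose = R := by
    have := (Matrix.nonneg_iff_posSemidef.1 (CFC.sqrt_nonneg H0)).isHermitian
    rwa [Matrix.IsHermitian, Matrix.conjTranspose_eq_transpose_of_trivial] at this
  have hRis : (R⁻¹).transpose = R⁻¹ := by rw [Matrix.transpose_nonsing_inv, hRs]
  set T := R⁻¹ * H1 * R⁻¹ with hT
  have hT0 : T.PosSemidef := by
    have := h1.conjTranspose_mul_mul_same R⁻¹
    rwa [Matrix.conjTranspose_eq_transpose_of_trivial, hRis] at this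
  have hT1 : (1 - T).PosSemidef := by
    have := h2.conjTranspose_mul_mul_same R⁻¹
    rw [Matrix.conjTranspose_eq_transpose_of_trivial, hRis, mul_sub, sub_mul, ← hT, ← hRR,
      Matrix.nonsing_inv_mul_cancel_left _ _ hRdet, Matrix.mul_nonsing_inv _ hRdet] at this
    exact this
  have hTs : T.transpose = T := by
    have := hT0.isHermitian
    rwa [Matrix.IsHermitian, Matrix.conjTranspose_eq_transpose_of_trivial] at this
  have hTR : T * R = R⁻¹ * H1 := by
    rw [hT, Matrix.mul_assoc, Matrix.nonsing_inv_mul _ hRdet, mul_one]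
  -- `T` shifts block `j` to block `j + 1`, because column `j` of `H1` is column `j + 1` of `H0`.
  -- This holds as long as the target block exists, so up to `T^m`.
  have hpow : ∀ j (hj : j < m + 1), T ^ j * (R * blockUnit (m + 1) p 0) =
      R * blockUnit (m + 1) p ⟨j, hj⟩ := by
    intro j
    induction j with
    | zero => intro _; simp
    | succ j ih =>
      intro hj
      have hcol : H1 * blockUnit (m + 1) p ⟨j, by omega⟩ = H0 * blockUnit (m + 1) p ⟨j + 1, hj⟩ := by
        ext a b
        rw [mul_blockUnit_apply, mul_blockUnit_apply]
        simp only [hH0, hH1, blockHankel, Matrix.of_apply]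
        rw [show 1 + (a.1 : ℕ) + j = 0 + a.1 + (j + 1) by ring]
      rw [pow_succ', Matrix.mul_assoc, ih (by omega), ← Matrix.mul_assoc, hTR, Matrix.mul_assoc,
        hcol, ← hRR, Matrix.mul_assoc, Matrix.nonsing_inv_mul_cancel_left _ _ hRdet]
  set Z := R * blockUnit (m + 1) p 0 with hZ
  have hZZ : Z.transpose * Z = 1 := by
    rw [hZ, Matrix.transpose_mul, hRs, Matrix.mul_assoc, ← Matrix.mul_assoc R R, hRR, ← hc0]
    ext a b
    rw [blockUnit_transpose_mul_apply, mul_blockUnit_apply]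
    simp [hH0, blockHankel]
  obtain ⟨μ, hμ⟩ := exists_measure_of_contraction hT0 hT1 Z hZZ
  refine ⟨μ, fun k hk => ?_⟩
  rw [hμ]
  rcases Nat.eq_zero_or_pos k with rfl | hk0
  · rw [pow_zero, Matrix.mul_one, hZZ, hc0]
  -- With `a, b ≤ m`, splitting `T^k = T^a T T^b` leaves a single entry of `H1`; such splittings
  -- reach exactly `k = 1, …, 2m + 1`.
  · obtain ⟨a, b, ha, hb, rfl⟩ : ∃ a b, a < m + 1 ∧ b < m + 1 ∧ k = a + 1 + b := by
      rcases Nat.lt_or_ge (k - 1) (m + 1) with h | h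
      · exact ⟨k - 1, 0, h, by omega, by omega⟩
      · exact ⟨m, k - 1 - m, by omega, by omega, by omega⟩
    have hpa : Z.transpose * T ^ a = (R * blockUnit (m + 1) p ⟨a, ha⟩).transpose := by
      rw [← hpow a ha, Matrix.transpose_mul (T ^ a) Z, Matrix.transpose_pow, hTs]
    have hsplit : Z.transpose * T ^ (a + 1 + b) * Z = Z.transpose * T ^ a * (T * (T ^ b * Z)) := by
      clear_value Z
      rw [pow_add, pow_succ]
      simp only [Matrix.mul_assoc]
    rw [hsplit, hpow b hb, hpa, Matrix.transpose_mul, hRs, Matrix.mul_assoc, ← Matrix.mul_assoc T, hTR,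
      Matrix.mul_assoc, Matrix.mul_nonsing_inv_cancel_left _ _ hRdet]
    ext i j
    rw [blockUnit_transpose_mul_apply, mul_blockUnit_apply]
    simp only [hH1, blockHankel, Matrix.of_apply]
    rw [show 1 + a + b = a + 1 + b by ring]

/-- Only the corner block contains the element of highest index. Without it the Schur complement is
a function of the earlier elements, which is what makes the moment bounds depend on the past alone.
-/
lemma schur_sub_congr {d d' : ℕ → Matrix (Fin p) (Fin p) ℝ} {s m : ℕ}
    (h : ∀ i, i < s + 2 * m → d i = d' i) :
    schur d s m - d (s + 2 * m) = schur d' s m - d' (s + 2 * m) := by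
  have h2 : blockColumn d (s + m) m = blockColumn d' (s + m) m := by
    ext a b
    simp only [blockColumn, Matrix.of_apply]
    rw [h _ (by omega)]
  rw [schur, schur, h2, blockHankel_congr fun i hi => h i (by omega)]
  abel

lemma lowerGap_sub_congr {c c' : ℕ → Matrix (Fin p) (Fin p) ℝ} {k : ℕ}
    (h : ∀ i < k, c i = c' i) : lowerGap c k - c k = lowerGap c' k - c' k := by
  have := schur_sub_congr (d := c) (d' := c') (s := k % 2) (m := k / 2)
    fun i hi => h i (by omega)
  rwa [show k % 2 + 2 * (k / 2) = k by omega] at this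

lemma upperGap_add_congr {c c' : ℕ → Matrix (Fin p) (Fin p) ℝ} {k : ℕ}
    (h : ∀ i < k + 1, c i = c' i) :
    upperGap c k + c (k + 1) = upperGap c' k + c' (k + 1) := by
  have := schur_sub_congr (d := diffSeq c) (d' := diffSeq c') (s := k % 2) (m := k / 2)
    fun i hi => by rw [diffSeq, diffSeq, h i (by omega), h (i + 1) (by omega)]
  rw [show k % 2 + 2 * (k / 2) = k by omega, diffSeq, diffSeq, h k (by omega)] at this
  have h3 := congrArg (· + c' k) this
  unfold upperGap
  convert h3 using 1 <;> abel

lemma lowerGap_congr {c c' : ℕ → Matrix (Fin p) (Fin p) ℝ} {k : ℕ}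
    (h : ∀ i < k + 1, c i = c' i) : lowerGap c k = lowerGap c' k := by
  have := lowerGap_sub_congr fun i (hi : i < k) => h i (by omega)
  rwa [h k (by omega), sub_left_inj] at this

lemma upperGap_congr {c c' : ℕ → Matrix (Fin p) (Fin p) ℝ} {k : ℕ}
    (h : ∀ i < k + 2, c i = c' i) : upperGap c k = upperGap c' k := by
  have := upperGap_add_congr fun i (hi : i < k + 1) => h i (by omega)
  rwa [h (k + 1) (by omega), add_left_inj] at this

lemma exists_measure_of_gaps_odd {c : ℕ → Matrix (Fin p) (Fin p) ℝ} (hc : ∀ k, (c k).IsSymm)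
    (hc0 : c 0 = 1) {m : ℕ} (hA : ∀ k < 2 * m + 2, (lowerGap c k).PosDef)
    (hB : ∀ k < 2 * m + 1, (upperGap c k).PosDef) :
    ∃ μ : MatrixMeasure p, ∀ k ≤ 2 * m + 1, μ.moment k = c k := by
  have hA' := (blockHankel_posDef_iff hc _).2 hA
  have hB' := (blockHankel_posDef_iff (diffSeq_isSymm hc) _).2 hB
  exact exists_measure_of_hankel hc0 (hA' _ (by omega) _ (by omega))
    (hA' _ (by omega) _ (by omega)).posSemidef (hB' _ (by omega) _ (by omega)).posSemidef

/-- The range of the next moment has positive definite width. -/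
lemma posDef_gap_add_gap {c : ℕ → Matrix (Fin p) (Fin p) ℝ} (hc : ∀ k, (c k).IsSymm)
    (hc0 : c 0 = 1) {n : ℕ} (hA : ∀ k < n + 1, (lowerGap c k).PosDef)
    (hB : ∀ k < n, (upperGap c k).PosDef) : (lowerGap c (n + 1) + upperGap c n).PosDef := by
  rcases n with _ | n
  · have : lowerGap c (0 + 1) + upperGap c 0 = 1 := by
      unfold lowerGap upperGap
      norm_num
      rw [schur_zero, schur_zero, diffSeq, hc0]
      abel
    rw [this]
    exact Matrix.PosDef.one
  · rw [gap_parallel hc hA hB]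
    exact posDef_parallel (hA _ (by omega)) (hB _ (by omega))

lemma isSymm_of_posDef {ι : Type*} [Fintype ι] {A : Matrix ι ι ℝ} (hA : A.PosDef) : A.IsSymm := by
  have := hA.isHermitian
  rwa [Matrix.IsHermitian, Matrix.conjTranspose_eq_transpose_of_trivial] at this

/-- A sequence with positive definite gaps up to a given index can be continued by the midpoint of
the range of the next moment. -/
lemma exists_gap_extension {c : ℕ → Matrix (Fin p) (Fin p) ℝ} (hc : ∀ k, (c k).IsSymm)
    (hc0 : c 0 = 1) {n : ℕ} (hA : ∀ k < n + 1, (lowerGap c k).PosDef)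
    (hB : ∀ k < n, (upperGap c k).PosDef) :
    ∃ c' : ℕ → Matrix (Fin p) (Fin p) ℝ, (∀ k, (c' k).IsSymm) ∧ (∀ k < n + 1, c' k = c k) ∧
      (∀ k < n + 2, (lowerGap c' k).PosDef) ∧ ∀ k < n + 1, (upperGap c' k).PosDef := by
  set D := lowerGap c (n + 1) + upperGap c n with hDdef
  have hD : D.PosDef := posDef_gap_add_gap hc hc0 hA hB
  have hD2 : ((2⁻¹ : ℝ) • D).PosDef := hD.smul (by norm_num)
  -- `c (n+1) - lowerGap c (n+1)` is the lower bound of the next moment, whatever value `c (n+1)`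
  -- has; half the width is added to it.
  set e := c (n + 1) - lowerGap c (n + 1) + (2⁻¹ : ℝ) • D with he
  set c' := Function.update c (n + 1) e with hc'
  have hcc : ∀ i < n + 1, c' i = c i := fun i hi => Function.update_of_ne (by omega) _ _
  have hce : c' (n + 1) = e := Function.update_self _ _ _
  have hlow : lowerGap c' (n + 1) = (2⁻¹ : ℝ) • D := by
    have := lowerGap_sub_congr hcc
    rw [hce, he] at this
    rw [sub_eq_iff_eq_add.1 this]; abel
  have hupp : upperGap c' n = (2⁻¹ : ℝ) • D := by
    have := upperGap_add_congr hcc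
    rw [hce, he] at this
    rw [eq_sub_of_add_eq this]
    have h2 : D = (2⁻¹ : ℝ) • D + (2⁻¹ : ℝ) • D := by
      rw [← add_smul]; norm_num
    have h3 : upperGap c n = D - lowerGap c (n + 1) := by rw [hDdef]; abel
    rw [h3]
    nth_rewrite 1 [h2]
    abel
  have hlowsym : (lowerGap c (n + 1)).IsSymm :=
    Matrix.IsSymm.sub (hc _) (isSymm_conj (isSymm_inv (blockHankel_isSymm hc _ _)) _)
  refine ⟨c', fun k => ?_, hcc, fun k hk => ?_, fun k hk => ?_⟩
  · rcases eq_or_ne k (n + 1) with rfl | h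
    · rw [hce]
      exact ((hc _).sub hlowsym).add ((isSymm_of_posDef hD).smul _)
    · rw [hc', Function.update_of_ne h]; exact hc k
  · rcases Nat.lt_or_ge k (n + 1) with h | h
    · rw [lowerGap_congr fun i hi => hcc i (by omega)]
      exact hA k (by omega)
    · obtain rfl : k = n + 1 := by omega
      rw [hlow]; exact hD2
  · rcases Nat.lt_or_ge k n with h | h
    · rw [upperGap_congr fun i hi => hcc i (by omega)]
      exact hB k (by omega)
    · obtain rfl : k = n := by omega
      rw [hupp]; exact hD2

/-- A sequence with positive definite gaps is a moment sequence. -/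
theorem exists_measure_of_gaps {c : ℕ → Matrix (Fin p) (Fin p) ℝ} (hc : ∀ k, (c k).IsSymm)
    (hc0 : c 0 = 1) {n : ℕ} (hA : ∀ k < n + 1, (lowerGap c k).PosDef)
    (hB : ∀ k < n, (upperGap c k).PosDef) :
    ∃ μ : MatrixMeasure p, ∀ k ≤ n, μ.moment k = c k := by
  rcases Nat.even_or_odd' n with ⟨m, rfl | rfl⟩
  -- The Hankel construction reaches an odd last index, so for even `n` one more moment is appended
  -- first.
  · obtain ⟨c', hc', hcc, hA', hB'⟩ := exists_gap_extension hc hc0 hA hB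
    obtain ⟨μ, hμ⟩ := exists_measure_of_gaps_odd hc' (by rw [hcc 0 (by omega), hc0]) hA' hB'
    exact ⟨μ, fun k hk => by rw [hμ k (by omega), hcc k (by omega)]⟩
  · exact exists_measure_of_gaps_odd hc hc0 hA hB

/-- There are sequences with positive definite gaps. -/
lemma exists_gaps_posDef (p n : ℕ) : ∃ c : ℕ → Matrix (Fin p) (Fin p) ℝ, (∀ k, (c k).IsSymm) ∧
    c 0 = 1 ∧ (∀ k < n + 1, (lowerGap c k).PosDef) ∧ ∀ k < n, (upperGap c k).PosDef := by
  induction n with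
  | zero =>
    refine ⟨fun _ => 1, fun _ => Matrix.isSymm_one, rfl, fun k hk => ?_, fun k hk => by omega⟩
    obtain rfl : k = 0 := by omega
    unfold lowerGap
    rw [schur_zero]
    exact Matrix.PosDef.one
  | succ n ih =>
    obtain ⟨c, hc, hc0, hA, hB⟩ := ih
    obtain ⟨c', hc', hcc, hA', hB'⟩ := exists_gap_extension hc hc0 hA hB
    exact ⟨c', hc', by rw [hcc 0 (by omega), hc0], hA', hB'⟩

end MomentsSufficient

/-! ### Haar measure on symmetric matrices and the Jacobian of a congruence. -/

section Lebesgue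

variable {p : ℕ}

section FiniteDimensional

variable {E : Type*} [AddCommGroup E] [Module ℝ E] [TopologicalSpace E] [IsTopologicalAddGroup E]
  [ContinuousSMul ℝ E] [T2Space E] [FiniteDimensional ℝ E] [MeasurableSpace E] [BorelSpace E]
  (μ : Measure E) [μ.IsAddHaarMeasure]

/-- The frontier of a convex set is null for a Haar measure of a finite-dimensional topological
vector space. -/
lemma addHaar_frontier_of_convex {s : Set E} (hs : Convex ℝ s) : μ (frontier s) = 0 := by
  -- Linear coordinates transfer the question to a normed space.
  set e : E ≃L[ℝ] (Fin (Module.finrank ℝ E) → ℝ) := (Module.finBasis ℝ E).equivFunL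
  have h : (μ.map e) (frontier (e.symm ⁻¹' s)) = 0 :=
    Convex.addHaar_frontier _ (hs.linear_preimage e.symm.toLinearEquiv.toLinearMap)
  rw [show (e : E → _) = e.toHomeomorph.toMeasurableEquiv from rfl, MeasurableEquiv.map_apply] at h
  convert h using 2
  change _ = e.toHomeomorph ⁻¹' frontier (e.toHomeomorph.symm ⁻¹' s)
  rw [e.toHomeomorph.preimage_frontier, ← Set.preimage_comp]
  simp

lemma map_linearMap_addHaar {f : E →ₗ[ℝ] E} (hf : LinearMap.det f ≠ 0) :
    μ.map f = ENNReal.ofReal |(LinearMap.det f)⁻¹| • μ := by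
  set e : E ≃L[ℝ] (Fin (Module.finrank ℝ E) → ℝ) := (Module.finBasis ℝ E).equivFunL
  have hdet := LinearMap.det_conj f e.toLinearEquiv
  have h := Measure.map_linearMap_addHaar_eq_smul_addHaar (μ.map e) (by rwa [hdet])
  have hfm : Measurable f := (LinearMap.continuous_of_finiteDimensional f).measurable
  have hgm : Measurable (e.toLinearEquiv.toLinearMap ∘ₗ f ∘ₗ
      e.toLinearEquiv.symm.toLinearMap) :=
    (LinearMap.continuous_of_finiteDimensional _).measurable
  rw [hdet, Measure.map_map hgm e.continuous.measurable] at h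
  have h2 := congrArg (Measure.map e.symm) h
  rw [Measure.map_smul, Measure.map_map e.symm.continuous.measurable
    (hgm.comp e.continuous.measurable), Measure.map_map e.symm.continuous.measurable
    e.continuous.measurable] at h2
  have h3 : e.symm ∘ e = id := by funext x; simp
  rw [h3, Measure.map_id] at h2
  rw [← h2]
  congr 1
  funext x
  simp

end FiniteDimensional

/-- The independent entries of a symmetric matrix. -/
abbrev UpperIndex (p : ℕ) : Type := {ij : Fin p × Fin p // ij.1 ≤ ij.2}

/-- The linear coordinates on the space of symmetric matrices. -/
def upperEquiv (p : ℕ) : (UpperIndex p → ℝ) ≃ₗ[ℝ] SymMat p where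
  toFun := symOfUpper p
  map_add' _ _ := rfl
  map_smul' _ _ := rfl
  invFun X ij := X.1 ij.1.1 ij.1.2
  left_inv x := by
    funext ⟨⟨i, j⟩, h⟩
    simp only [symOfUpper, Matrix.of_apply]
    congr 2
    simp only [Prod.mk.injEq]
    exact ⟨min_eq_left h, max_eq_right h⟩
  right_inv X := by
    ext i j
    simp only [symOfUpper, Matrix.of_apply]
    rcases le_total i j with h | h
    · rw [min_eq_left h, max_eq_right h]
    · rw [min_eq_right h, max_eq_left h]
      exact X.2.apply i j

instance : FiniteDimensional ℝ (SymMat p) := (upperEquiv p).finiteDimensional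

instance : SecondCountableTopology (SymMat p) :=
  (upperEquiv p).toContinuousLinearEquiv.toHomeomorph.symm.secondCountableTopology

instance : (symLebesgue p).IsAddHaarMeasure :=
  (upperEquiv p).toContinuousLinearEquiv.isAddHaarMeasure_map volume

instance : SigmaFinite (symLebesgue p) :=
  (upperEquiv p).toContinuousLinearEquiv.toHomeomorph.toMeasurableEquiv.sigmaFinite_map

instance : PolishSpace (SymMat p) :=
  (upperEquiv p).toContinuousLinearEquiv.toHomeomorph.symm.isClosedEmbedding.polishSpace

instance (n : ℕ) : (tupleLebesgue n p).IsAddHaarMeasure :=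
  inferInstanceAs (Measure.pi fun _ : Fin n => symLebesgue p).IsAddHaarMeasure

lemma continuous_entry (i j : Fin p) : Continuous fun X : SymMat p => X.1 i j :=
  (continuous_apply_apply i j).comp continuous_subtype_val

/-- Congruence transformation of symmetric matrices. -/
def congrMap (C : Matrix (Fin p) (Fin p) ℝ) : SymMat p →ₗ[ℝ] SymMat p where
  toFun X := ⟨C * X.1 * C.transpose, by
    have := isSymm_conj X.2 C.transpose
    rwa [Matrix.transpose_transpose] at this⟩
  map_add' X Y := by
    ext1
    simp [mul_add, add_mul]
  map_smul' a X := by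
    ext1
    simp

lemma congrMap_apply (C : Matrix (Fin p) (Fin p) ℝ) (X : SymMat p) :
    (congrMap C X : Matrix (Fin p) (Fin p) ℝ) = C * X * C.transpose := rfl

lemma congrMap_mul (C C' : Matrix (Fin p) (Fin p) ℝ) :
    congrMap (C * C') = congrMap C ∘ₗ congrMap C' := by
  ext1 X
  apply Subtype.ext
  simp only [LinearMap.comp_apply, congrMap_apply, Matrix.transpose_mul, Matrix.mul_assoc]

lemma congrMap_one : congrMap (1 : Matrix (Fin p) (Fin p) ℝ) = LinearMap.id := by
  ext1 X
  apply Subtype.ext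
  simp [congrMap_apply]

/-- The index `i` occurs `p - i` times as the smaller and `i + 1` times as the larger of the two,
counting from zero. -/
lemma prod_upperIndex (w : Fin p → ℝ) :
    ∏ ij : UpperIndex p, w ij.1.1 * w ij.1.2 = (∏ i, w i) ^ (p + 1) := by
  have h1 : ∀ f : Fin p × Fin p → ℝ, ∏ ij : UpperIndex p, f ij.1 =
      ∏ i, ∏ j, if i ≤ j then f (i, j) else 1 := by
    intro f
    rw [← Fintype.prod_prod_type' (f := fun i j => if i ≤ j then f (i, j) else 1),
      ← Finset.prod_filter, Finset.prod_subtype (p := fun ij : Fin p × Fin p => ij.1 ≤ ij.2)]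
    simp
  rw [Finset.prod_mul_distrib, h1 fun ij => w ij.1, h1 fun ij => w ij.2]
  rw [Finset.prod_comm (f := fun i j => if i ≤ j then w (i, j).2 else 1), ← Finset.prod_mul_distrib,
    ← Finset.prod_pow]
  refine Finset.prod_congr rfl fun i _ => ?_
  simp only [← Finset.prod_filter, Finset.prod_const, ← pow_add]
  congr 1
  rw [Finset.filter_le_eq_Ici, Finset.filter_ge_eq_Iic, Fin.card_Ici, Fin.card_Iic]
  omega

lemma det_congrMap_diagonal (w : Fin p → ℝ) :
    LinearMap.det (congrMap (Matrix.diagonal w)) = (∏ i, w i) ^ (p + 1) := by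
  rw [← prod_upperIndex, ← Matrix.det_diagonal, ← LinearMap.det_toLin',
    ← LinearMap.det_conj _ (upperEquiv p)]
  congr 1
  ext1 X
  obtain ⟨x, rfl⟩ := (upperEquiv p).surjective X
  apply (upperEquiv p).symm.injective
  simp only [LinearMap.comp_apply, LinearEquiv.coe_coe, LinearEquiv.symm_apply_apply]
  funext ij
  rw [Matrix.toLin'_apply, Matrix.mulVec_diagonal]
  change (Matrix.diagonal w * (symOfUpper p x).1 * (Matrix.diagonal w).transpose) ij.1.1 ij.1.2 = _
  rw [Matrix.diagonal_transpose, Matrix.mul_diagonal, Matrix.diagonal_mul]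
  have : (symOfUpper p x).1 ij.1.1 ij.1.2 = x ij := congrFun ((upperEquiv p).left_inv x) ij
  rw [this]
  ring

/-- The Jacobian of a congruence transformation by a symmetric matrix. -/
theorem det_congrMap {C : Matrix (Fin p) (Fin p) ℝ} (hC : C.IsSymm) :
    LinearMap.det (congrMap C) = C.det ^ (p + 1) := by
  have hH : C.IsHermitian := by
    rwa [Matrix.IsHermitian, Matrix.conjTranspose_eq_transpose_of_trivial]
  set Q : Matrix (Fin p) (Fin p) ℝ := (hH.eigenvectorUnitary : Matrix (Fin p) (Fin p) ℝ) with hQ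
  have hQQ : Q.transpose * Q = 1 := by
    have := Unitary.coe_star_mul_self hH.eigenvectorUnitary
    rwa [Matrix.star_eq_conjTranspose, Matrix.conjTranspose_eq_transpose_of_trivial] at this
  have hT : C = Q * Matrix.diagonal hH.eigenvalues * Q.transpose := by
    have := hH.spectral_theorem
    rw [Unitary.conjStarAlgAut_apply, Matrix.star_eq_conjTranspose,
      Matrix.conjTranspose_eq_transpose_of_trivial] at this
    simpa using this
  -- The orthogonal factors cancel against each other, so only the diagonal congruence contributes
  -- to the Jacobian.
  have h1 : LinearMap.det (congrMap Q.transpose) * LinearMap.det (congrMap Q) = 1 := by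
    rw [← LinearMap.det_comp, ← congrMap_mul, hQQ, congrMap_one, LinearMap.det_id]
  have h2 : C.det = ∏ i, hH.eigenvalues i := by
    simpa using hH.det_eq_prod_eigenvalues
  rw [h2, ← det_congrMap_diagonal]
  conv_lhs => rw [hT]
  rw [congrMap_mul, congrMap_mul, LinearMap.det_comp, LinearMap.det_comp, mul_right_comm,
    mul_comm (LinearMap.det (congrMap Q)), h1, one_mul]

/-- The affine change of variables `U = C⁻¹ (X - M) C⁻¹`. -/
lemma lintegral_congrMap_inv_sub {C : Matrix (Fin p) (Fin p) ℝ} (hC : C.IsSymm) (hdet : 0 < C.det)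
    (M : SymMat p) {h : SymMat p → ENNReal} (hh : Measurable h) :
    ∫⁻ X, h (congrMap C⁻¹ (X - M)) ∂(symLebesgue p) =
      ENNReal.ofReal (C.det ^ (p + 1)) * ∫⁻ U, h U ∂(symLebesgue p) := by
  have hd : LinearMap.det (congrMap C⁻¹) = (C.det ^ (p + 1))⁻¹ := by
    rw [det_congrMap (isSymm_inv hC), Matrix.det_nonsing_inv, Ring.inverse_eq_inv', inv_pow]
  have hpos : 0 < C.det ^ (p + 1) := pow_pos hdet _
  have hmeas : Measurable (congrMap (p := p) C⁻¹) :=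
    (LinearMap.continuous_of_finiteDimensional _).measurable
  rw [lintegral_sub_right_eq_self (fun X => h (congrMap C⁻¹ X)) M,
    ← lintegral_map hh hmeas,
    map_linearMap_addHaar _ (by rw [hd]; positivity), lintegral_smul_measure,
    hd, inv_inv, abs_of_pos hpos, smul_eq_mul]

end Lebesgue

/-! ### Measurability of matrix operations. -/

section EntryMeasurable

variable {p : ℕ} {α : Type*} [MeasurableSpace α]

/-- A matrix valued function all of whose entries are measurable. -/
def EntryMeasurable {ι κ : Type*} (f : α → Matrix ι κ ℝ) : Prop :=
  ∀ i j, Measurable fun a => f a i j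

variable {ι κ l : Type*}

lemma EntryMeasurable.mul [Fintype κ] {f : α → Matrix ι κ ℝ} {g : α → Matrix κ l ℝ}
    (hf : EntryMeasurable f) (hg : EntryMeasurable g) : EntryMeasurable fun a => f a * g a :=
  fun i j => Finset.measurable_sum _ fun x _ => (hf i x).mul (hg x j)

lemma EntryMeasurable.sub {f g : α → Matrix ι κ ℝ} (hf : EntryMeasurable f)
    (hg : EntryMeasurable g) : EntryMeasurable fun a => f a - g a :=
  fun i j => (hf i j).sub (hg i j)

lemma EntryMeasurable.transpose {f : α → Matrix ι κ ℝ} (hf : EntryMeasurable f) :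
    EntryMeasurable fun a => (f a).transpose :=
  fun i j => hf j i

lemma entryMeasurable_const (A : Matrix ι κ ℝ) : EntryMeasurable fun _ : α => A :=
  fun _ _ => measurable_const

lemma EntryMeasurable.det [Fintype ι] [DecidableEq ι] {f : α → Matrix ι ι ℝ}
    (hf : EntryMeasurable f) : Measurable fun a => (f a).det := by
  simp only [Matrix.det_apply]
  exact Finset.measurable_sum _ fun σ _ =>
    (Finset.measurable_prod _ fun i _ => hf (σ i) i).const_smul (Equiv.Perm.sign σ)

lemma EntryMeasurable.trace [Fintype ι] {f : α → Matrix ι ι ℝ}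
    (hf : EntryMeasurable f) : Measurable fun a => (f a).trace :=
  Finset.measurable_sum _ fun i _ => hf i i

lemma EntryMeasurable.inv [Fintype ι] [DecidableEq ι] {f : α → Matrix ι ι ℝ}
    (hf : EntryMeasurable f) : EntryMeasurable fun a => (f a)⁻¹ := by
  intro i j
  simp only [Matrix.inv_def, Matrix.smul_apply, Ring.inverse_eq_inv', smul_eq_mul,
    Matrix.adjugate_apply]
  refine hf.det.inv.mul (EntryMeasurable.det fun x y => ?_)
  simp only [Matrix.updateRow_apply]
  split_ifs
  · exact measurable_const
  · exact hf x y

lemma entryMeasurable_coe : EntryMeasurable fun X : SymMat p => (X : Matrix (Fin p) (Fin p) ℝ) :=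
  fun i j => (continuous_entry i j).measurable

lemma EntryMeasurable.comp {β : Type*} [MeasurableSpace β] {f : α → Matrix ι κ ℝ}
    (hf : EntryMeasurable f) {g : β → α} (hg : Measurable g) : EntryMeasurable fun b => f (g b) :=
  fun i j => (hf i j).comp hg

lemma measurable_of_entryMeasurable {f : α → SymMat p}
    (hf : EntryMeasurable fun a => (f a : Matrix (Fin p) (Fin p) ℝ)) : Measurable f := by
  have h : Measurable fun a => (upperEquiv p) ((upperEquiv p).symm (f a)) :=
    (upperEquiv p).toContinuousLinearEquiv.continuous.measurable.comp
      (measurable_pi_iff.2 fun ij => hf ij.1.1 ij.1.2)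
  simpa using h

lemma measurableSet_posSemidef [Fintype ι] {f : α → Matrix ι ι ℝ} (hf : EntryMeasurable f)
    (hs : ∀ a, (f a).IsSymm) : MeasurableSet {a | (f a).PosSemidef} := by
  have h1 : {a | (f a).PosSemidef} =
      (fun a (i j : ι) => f a i j) ⁻¹' {A : ι → ι → ℝ | ∀ x : ι → ℝ,
        0 ≤ ∑ i, x i * ∑ j, A i j * x j} := by
    ext a
    refine ⟨fun h x => by simpa [dotProduct, Matrix.mulVec] using h.dotProduct_mulVec_nonneg x,
      fun h => Matrix.PosSemidef.of_dotProduct_mulVec_nonneg ?_ fun x => ?_⟩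
    · rw [Matrix.IsHermitian, Matrix.conjTranspose_eq_transpose_of_trivial]; exact hs a
    · simpa [dotProduct, Matrix.mulVec] using h x
  rw [h1]
  refine (measurable_pi_iff.2 fun i => measurable_pi_iff.2 fun j => hf i j) (IsClosed.measurableSet ?_)
  rw [Set.ofPred_forall]
  exact isClosed_iInter fun x => isClosed_le continuous_const (by fun_prop)

lemma measurableSet_posDef [Fintype ι] [DecidableEq ι] {f : α → Matrix ι ι ℝ}
    (hf : EntryMeasurable f) (hs : ∀ a, (f a).IsSymm) : MeasurableSet {a | (f a).PosDef} := by
  have : {a | (f a).PosDef} = {a | (f a).PosSemidef} ∩ {a | (f a).det ≠ 0} := by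
    ext a
    exact ⟨fun h => ⟨h.posSemidef, h.det_pos.ne'⟩, fun h => (h.1.posDef_iff_det_ne_zero).2 h.2⟩
  rw [this]
  exact (measurableSet_posSemidef hf hs).inter (hf.det (measurableSet_singleton 0).compl)

/-- The square root of positive semidefinite matrices is measurable. -/
lemma exists_measurable_sqrt (p : ℕ) : ∃ g : SymMat p → SymMat p, Measurable g ∧
    ∀ X : SymMat p, (X : Matrix (Fin p) (Fin p) ℝ).PosSemidef →
      (g X : Matrix (Fin p) (Fin p) ℝ) = CFC.sqrt (X : Matrix (Fin p) (Fin p) ℝ) := by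
  set K : Set (SymMat p) := {X | (X : Matrix (Fin p) (Fin p) ℝ).PosSemidef}
  have hK : MeasurableSet K := measurableSet_posSemidef entryMeasurable_coe fun X => X.2
  set f : K → SymMat p := fun X => ⟨X.1.1 * X.1.1, by
    have := isSymm_conj (Matrix.isSymm_one (n := Fin p) (α := ℝ)) X.1.1
    rwa [mul_one, X.1.2.eq] at this⟩ with hf
  have hfm : Measurable f := measurable_of_entryMeasurable
    ((entryMeasurable_coe.comp measurable_subtype_coe).mul
      (entryMeasurable_coe.comp measurable_subtype_coe))
  have hinj : Function.Injective f := by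
    intro X Y h
    have h' : X.1.1 * X.1.1 = Y.1.1 * Y.1.1 := congrArg Subtype.val h
    have hX : (X.1.1).PosSemidef := X.2
    have hY : (Y.1.1).PosSemidef := Y.2
    apply Subtype.ext
    apply Subtype.ext
    rw [← CFC.sqrt_mul_self X.1.1 hX.nonneg, h', CFC.sqrt_mul_self Y.1.1 hY.nonneg]
  have : StandardBorelSpace K := hK.standardBorel
  -- Squaring is injective and measurable on the Borel set of semidefinite matrices. Between
  -- standard Borel spaces this makes it a measurable embedding (Lusin–Souslin), so its inverse
  -- extends measurably.
  obtain ⟨g, hg, hgf⟩ := (hfm.measurableEmbedding hinj).exists_measurable_extend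
    (measurable_subtype_coe (p := (· ∈ K))) (fun _ => ⟨0⟩)
  refine ⟨g, hg, fun X hX => ?_⟩
  have hs := Matrix.nonneg_iff_posSemidef.1 (CFC.sqrt_nonneg X.1)
  set Y : K := ⟨⟨CFC.sqrt X.1, by
    have := hs.isHermitian
    rwa [Matrix.IsHermitian, Matrix.conjTranspose_eq_transpose_of_trivial] at this⟩, hs⟩ with hY
  have hfY : f Y = X := Subtype.ext (CFC.sqrt_mul_sqrt_self X.1 hX.nonneg)
  have := congrFun hgf Y
  rw [Function.comp_apply, hfY] at this
  rw [this]

end EntryMeasurable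

/-! ### The set of positive definite gaps and its fibres over the earlier moments. -/

section Interior

variable {n p : ℕ}

lemma lowerMoment_eq (S : Fin n → SymMat p) (k : ℕ) :
    lowerMoment S (k + 1) = momentSeq S (k + 1) - lowerGap (momentSeq S) (k + 1) := by
  rcases k with _ | N
  · change 0 = momentSeq S 1 - schur (momentSeq S) 1 0
    rw [schur_zero, sub_self]
  · unfold lowerGap
    rw [show (N + 1 + 1) % 2 = N % 2 by omega, show (N + 1 + 1) / 2 = N / 2 + 1 by omega, schur,
      show N % 2 + 2 * (N / 2 + 1) = N + 1 + 1 by omega, sub_sub_cancel]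
    rfl

lemma upperMoment_eq (S : Fin n → SymMat p) (k : ℕ) :
    upperMoment S (k + 1) = momentSeq S (k + 1) + upperGap (momentSeq S) k := by
  rcases k with _ | _ | N
  · change 1 = momentSeq S 1 + schur (diffSeq (momentSeq S)) 0 0
    rw [schur_zero, diffSeq, momentSeq]; abel
  · change momentSeq S 1 = momentSeq S 2 + schur (diffSeq (momentSeq S)) 1 0
    rw [schur_zero, diffSeq]; abel
  · unfold upperGap
    rw [schur, show (N + 1 + 1) % 2 + 2 * ((N + 1 + 1) / 2) = N + 1 + 1 by omega]
    rw [show diffSeq (momentSeq S) (N + 1 + 1) =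
      momentSeq S (N + 1 + 1) - momentSeq S (N + 1 + 1 + 1) from rfl, ← add_sub_assoc, add_sub_cancel]
    rfl

/-- The moment of index `k + 1` cancels between the two gaps. Hence the formula is meaningful even
for `k = n`, where `momentSeq` takes its default value `0`. -/
lemma rangeWidth_eq (S : Fin n → SymMat p) (k : ℕ) :
    rangeWidth S (k + 1) = lowerGap (momentSeq S) (k + 1) + upperGap (momentSeq S) k := by
  rw [rangeWidth, lowerMoment_eq, upperMoment_eq]; abel

lemma lowerMoment_congr {m : ℕ} {S : Fin n → SymMat p} {T : Fin m → SymMat p} {k : ℕ}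
    (h : ∀ i < k + 1, momentSeq S i = momentSeq T i) :
    lowerMoment S (k + 1) = lowerMoment T (k + 1) := by
  have := lowerGap_sub_congr h
  rw [lowerMoment_eq, lowerMoment_eq, ← neg_sub, this, neg_sub]

lemma rangeWidth_congr {m : ℕ} {S : Fin n → SymMat p} {T : Fin m → SymMat p} {k : ℕ}
    (h : ∀ i < k + 1, momentSeq S i = momentSeq T i) :
    rangeWidth S (k + 1) = rangeWidth T (k + 1) := by
  rw [rangeWidth, rangeWidth, lowerMoment_congr h, upperMoment_eq, upperMoment_eq,
    add_comm, upperGap_add_congr h, add_comm]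

lemma momentSeq_zero (S : Fin n → SymMat p) : momentSeq S 0 = 1 := rfl

lemma momentSeq_succ (S : Fin n → SymMat p) (k : Fin n) : momentSeq S (k + 1) = (S k).1 := by
  simp [momentSeq]

lemma momentSeq_snoc (S : Fin n → SymMat p) (s : SymMat p) {k : ℕ} (hk : k < n + 1) :
    momentSeq (Fin.snoc S s : Fin (n + 1) → SymMat p) k = momentSeq S k := by
  rcases k with _ | k
  · rfl
  · have hk' : k < n := by omega
    have h1 := momentSeq_succ (Fin.snoc S s : Fin (n + 1) → SymMat p) (Fin.castSucc ⟨k, hk'⟩)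
    rw [Fin.snoc_castSucc] at h1
    exact h1.trans (momentSeq_succ S ⟨k, hk'⟩).symm

lemma momentSeq_snoc_last (S : Fin n → SymMat p) (s : SymMat p) :
    momentSeq (Fin.snoc S s : Fin (n + 1) → SymMat p) (n + 1) = s.1 := by
  have h1 := momentSeq_succ (Fin.snoc S s : Fin (n + 1) → SymMat p) (Fin.last n)
  rwa [Fin.snoc_last] at h1

/-- The tuples for which all gaps are positive definite. -/
def interiorSet (n p : ℕ) : Set (Fin n → SymMat p) :=
  {S | (∀ k < n + 1, (lowerGap (momentSeq S) k).PosDef) ∧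
    ∀ k < n, (upperGap (momentSeq S) k).PosDef}

lemma rangeWidth_posDef {S : Fin n → SymMat p} (hS : S ∈ interiorSet n p) {k : ℕ}
    (hk : k < n + 1) : (rangeWidth S (k + 1)).PosDef := by
  rw [rangeWidth_eq]
  exact posDef_gap_add_gap (momentSeq_isSymm S) rfl (fun i hi => hS.1 i (by omega))
    fun i hi => hS.2 i (by omega)

/-- The lower bound for the moment following the given ones. -/
noncomputable def nextLower (S : Fin n → SymMat p) : SymMat p :=
  ⟨lowerMoment S (n + 1), lowerMoment_isSymm S (n + 1)⟩

lemma lowerGap_snoc (S : Fin n → SymMat p) (s : SymMat p) :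
    lowerGap (momentSeq (Fin.snoc S s : Fin (n + 1) → SymMat p)) (n + 1) =
      (s - nextLower S : SymMat p) := by
  have h := lowerMoment_congr (k := n) (S := (Fin.snoc S s : Fin (n + 1) → SymMat p)) (T := S)
    fun i hi => momentSeq_snoc S s hi
  rw [lowerMoment_eq, momentSeq_snoc_last, sub_eq_iff_eq_add] at h
  rw [Submodule.coe_sub, h, nextLower]; abel

lemma rangeWidth_snoc (S : Fin n → SymMat p) (s : SymMat p) :
    rangeWidth (Fin.snoc S s : Fin (n + 1) → SymMat p) (n + 1) = rangeWidth S (n + 1) :=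
  rangeWidth_congr fun _ hi => momentSeq_snoc S s hi

lemma upperGap_snoc (S : Fin n → SymMat p) (s : SymMat p) :
    upperGap (momentSeq (Fin.snoc S s : Fin (n + 1) → SymMat p)) n =
      rangeWidth S (n + 1) - (s - nextLower S : SymMat p) := by
  rw [← rangeWidth_snoc S s, rangeWidth_eq, lowerGap_snoc]; abel

/-- A new last moment changes only the last lower and the last upper gap, so the fibre over an
interior point is the open Loewner interval between the two bounds. -/
lemma snoc_mem_interiorSet_iff (S : Fin n → SymMat p) (s : SymMat p) :
    (Fin.snoc S s : Fin (n + 1) → SymMat p) ∈ interiorSet (n + 1) p ↔ S ∈ interiorSet n p ∧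
      ((s - nextLower S : SymMat p) : Matrix (Fin p) (Fin p) ℝ).PosDef ∧
      (rangeWidth S (n + 1) - (s - nextLower S : SymMat p)).PosDef := by
  have hl : ∀ k < n + 1, lowerGap (momentSeq (Fin.snoc S s : Fin (n + 1) → SymMat p)) k =
      lowerGap (momentSeq S) k := fun k hk =>
    lowerGap_congr fun i hi => momentSeq_snoc S s (by omega)
  have hu : ∀ k < n, upperGap (momentSeq (Fin.snoc S s : Fin (n + 1) → SymMat p)) k =
      upperGap (momentSeq S) k := fun k hk =>
    upperGap_congr fun i hi => momentSeq_snoc S s (by omega)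
  constructor
  · intro h
    refine ⟨⟨fun k hk => ?_, fun k hk => ?_⟩, ?_, ?_⟩
    · rw [← hl k hk]; exact h.1 k (by omega)
    · rw [← hu k hk]; exact h.2 k (by omega)
    · rw [← lowerGap_snoc]; exact h.1 _ (by omega)
    · rw [← upperGap_snoc]; exact h.2 _ (by omega)
  · rintro ⟨h1, h2, h3⟩
    refine ⟨fun k hk => ?_, fun k hk => ?_⟩
    · rcases Nat.lt_succ_iff_lt_or_eq.1 hk with hk | rfl
      · rw [hl k hk]; exact h1.1 k hk
      · rw [lowerGap_snoc]; exact h2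
    · rcases Nat.lt_succ_iff_lt_or_eq.1 hk with hk | rfl
      · rw [hu k hk]; exact h1.2 k hk
      · rw [upperGap_snoc]; exact h3

lemma sqrt_isSymm (A : Matrix (Fin p) (Fin p) ℝ) : (CFC.sqrt A).IsSymm := by
  have h := (Matrix.nonneg_iff_posSemidef.mp (CFC.sqrt_nonneg A)).isHermitian
  rwa [Matrix.IsHermitian, Matrix.conjTranspose_eq_transpose_of_trivial] at h

lemma canonicalMoment_snoc_castSucc (S : Fin n → SymMat p) (s : SymMat p) (k : Fin n) :
    canonicalMoment (Fin.snoc S s : Fin (n + 1) → SymMat p) k.castSucc = canonicalMoment S k := by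
  apply Subtype.ext
  have h : ∀ i < (k : ℕ) + 1, momentSeq (Fin.snoc S s : Fin (n + 1) → SymMat p) i =
      momentSeq S i := fun i hi => momentSeq_snoc S s (by omega)
  simp only [canonicalMoment, Fin.val_castSucc, Fin.snoc_castSucc]
  rw [rangeWidth_congr h, lowerMoment_congr h]

lemma canonicalMoment_snoc_last (S : Fin n → SymMat p) (s : SymMat p) :
    canonicalMoment (Fin.snoc S s : Fin (n + 1) → SymMat p) (Fin.last n) =
      congrMap (CFC.sqrt (rangeWidth S (n + 1)))⁻¹ (s - nextLower S) := by
  apply Subtype.ext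
  have h : ∀ i < n + 1, momentSeq (Fin.snoc S s : Fin (n + 1) → SymMat p) i =
      momentSeq S i := fun i hi => momentSeq_snoc S s hi
  simp only [canonicalMoment, Fin.val_last, Fin.snoc_last]
  rw [rangeWidth_congr h, lowerMoment_congr h, congrMap_apply, (isSymm_inv (sqrt_isSymm _)).eq]
  rfl

/-- This is the triangular structure that drives the induction in the change of variables. -/
lemma canonicalMoment_snoc (S : Fin n → SymMat p) (s : SymMat p) :
    canonicalMoment (Fin.snoc S s : Fin (n + 1) → SymMat p) =
      (Fin.snoc (canonicalMoment S)
        (congrMap (CFC.sqrt (rangeWidth S (n + 1)))⁻¹ (s - nextLower S)) : Fin (n + 1) → SymMat p) := by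
  funext k
  refine Fin.lastCases ?_ (fun k => ?_) k
  · rw [canonicalMoment_snoc_last, Fin.snoc_last]
  · rw [canonicalMoment_snoc_castSucc, Fin.snoc_castSucc]

section Sqrt

variable {D : Matrix (Fin p) (Fin p) ℝ}

lemma sqrt_mul_self_of_posDef (hD : D.PosDef) : CFC.sqrt D * CFC.sqrt D = D :=
  CFC.sqrt_mul_sqrt_self D hD.posSemidef.nonneg

lemma det_sqrt_pos (hD : D.PosDef) : 0 < (CFC.sqrt D).det := by
  have h0 := (Matrix.nonneg_iff_posSemidef.mp (CFC.sqrt_nonneg D)).det_nonneg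
  refine lt_of_le_of_ne h0 fun h => hD.det_pos.ne' ?_
  rw [← sqrt_mul_self_of_posDef hD, Matrix.det_mul, ← h, mul_zero]

lemma isUnit_det_sqrt (hD : D.PosDef) : IsUnit (CFC.sqrt D).det :=
  isUnit_iff_ne_zero.2 (det_sqrt_pos hD).ne'

lemma one_sub_congrMap_sqrt_inv (hD : D.PosDef) (X : SymMat p) :
    1 - (congrMap (CFC.sqrt D)⁻¹ X : Matrix (Fin p) (Fin p) ℝ) =
      (CFC.sqrt D)⁻¹ * (D - X) * ((CFC.sqrt D)⁻¹).transpose := by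
  have hu := isUnit_det_sqrt hD
  have h1 : (CFC.sqrt D)⁻¹ * D * (CFC.sqrt D)⁻¹ = 1 := by
    nth_rewrite 2 [← sqrt_mul_self_of_posDef hD]
    rw [Matrix.nonsing_inv_mul_cancel_left _ _ hu, Matrix.mul_nonsing_inv _ hu]
  rw [congrMap_apply, mul_sub, sub_mul, (isSymm_inv (sqrt_isSymm D)).eq, h1]

lemma posDef_mul_mul_transpose_iff {C A : Matrix (Fin p) (Fin p) ℝ} (hC : IsUnit C.det) :
    (C * A * C.transpose).PosDef ↔ A.PosDef := by
  have := Matrix.IsUnit.posDef_star_right_conjugate_iff (x := A)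
    ((Matrix.isUnit_iff_isUnit_det C).2 hC)
  rwa [Matrix.star_eq_conjTranspose, Matrix.conjTranspose_eq_transpose_of_trivial] at this

lemma congrMap_sqrt_inv_mem_iff (hD : D.PosDef) (X : SymMat p) :
    congrMap (CFC.sqrt D)⁻¹ X ∈ loewnerInterval p ↔
      (X : Matrix (Fin p) (Fin p) ℝ).PosDef ∧ (D - X).PosDef := by
  have hu : IsUnit ((CFC.sqrt D)⁻¹).det := by
    rw [Matrix.det_nonsing_inv]
    exact (isUnit_det_sqrt hD).ringInverse
  rw [loewnerInterval, Set.mem_ofPred_eq, one_sub_congrMap_sqrt_inv hD, congrMap_apply,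
    posDef_mul_mul_transpose_iff hu, posDef_mul_mul_transpose_iff hu]

lemma det_sqrt_sq (hD : D.PosDef) : (CFC.sqrt D).det * (CFC.sqrt D).det = D.det := by
  rw [← Matrix.det_mul, sqrt_mul_self_of_posDef hD]

lemma det_sqrt_inv_mul (hD : D.PosDef) (A : Matrix (Fin p) (Fin p) ℝ) :
    ((CFC.sqrt D)⁻¹ * A * ((CFC.sqrt D)⁻¹).transpose).det = A.det / D.det := by
  rw [Matrix.det_mul, Matrix.det_mul, Matrix.det_transpose, Matrix.det_nonsing_inv,
    Ring.inverse_eq_inv', ← det_sqrt_sq hD]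
  have := (det_sqrt_pos hD).ne'
  field_simp

lemma det_congrMap_mul_one_sub (hD : D.PosDef) (X : SymMat p) :
    ((congrMap (CFC.sqrt D)⁻¹ X : Matrix (Fin p) (Fin p) ℝ) *
      (1 - (congrMap (CFC.sqrt D)⁻¹ X : Matrix (Fin p) (Fin p) ℝ))).det =
        (X : Matrix (Fin p) (Fin p) ℝ).det / D.det * ((D - X).det / D.det) := by
  rw [Matrix.det_mul, one_sub_congrMap_sqrt_inv hD, congrMap_apply, det_sqrt_inv_mul hD,
    det_sqrt_inv_mul hD]

lemma det_sqrt_pow (hD : D.PosDef) :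
    (CFC.sqrt D).det ^ (p + 1) = D.det ^ (((p : ℝ) + 1) / 2) := by
  have h0 := det_sqrt_pos hD
  rw [← det_sqrt_sq hD, ← sq, ← Real.rpow_natCast, ← Real.rpow_natCast, ← Real.rpow_mul h0.le]
  congr 1
  push_cast
  ring

end Sqrt

/-- The determinant of the width of the range of the next moment is the product of the
determinants of `U_k (1 - U_k)`. -/
theorem det_rangeWidth {S : Fin n → SymMat p} (hS : S ∈ interiorSet n p) :
    (rangeWidth S (n + 1)).det = ∏ k, ((canonicalMoment S k : Matrix (Fin p) (Fin p) ℝ) *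
      (1 - (canonicalMoment S k : Matrix (Fin p) (Fin p) ℝ))).det := by
  induction n with
  | zero =>
    rw [rangeWidth_eq]
    have : lowerGap (momentSeq S) (0 + 1) + upperGap (momentSeq S) 0 = 1 := by
      unfold lowerGap upperGap
      norm_num
      rw [schur_zero, schur_zero, diffSeq, momentSeq_zero]
      abel
    rw [this]
    simp
  | succ n ih =>
    obtain ⟨T, s, rfl⟩ : ∃ (T : Fin n → SymMat p) (s : SymMat p), S = Fin.snoc T s :=
      ⟨Fin.init S, S (Fin.last n), (Fin.snoc_init_self S).symm⟩
    have hT := ((snoc_mem_interiorSet_iff T s).1 hS).1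
    have hD := rangeWidth_posDef hT (k := n) (by omega)
    rw [Fin.prod_univ_castSucc]
    simp only [canonicalMoment_snoc_castSucc]
    -- With `D` the previous width, `det U = det A / det D` and `det (1 - U) = det B / det D`, while
    -- the recursion gives the new width determinant `det A · det B / det D`.
    rw [← ih hT, canonicalMoment_snoc_last, det_congrMap_mul_one_sub hD, rangeWidth_eq,
      gap_parallel (momentSeq_isSymm _) hS.1 hS.2, ← rangeWidth_eq, rangeWidth_snoc,
      lowerGap_snoc, upperGap_snoc, Matrix.det_mul, Matrix.det_mul, Matrix.det_nonsing_inv,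
      Ring.inverse_eq_inv']
    have := hD.det_pos.ne'
    field_simp

end Interior

/-! ### Integration over the moments in terms of the canonical moments. -/

section ChangeOfVariables

variable {n p : ℕ}

lemma entryMeasurable_momentSeq (k : ℕ) :
    EntryMeasurable fun S : Fin n → SymMat p => momentSeq S k := by
  rcases k with _ | k
  · exact entryMeasurable_const _
  · by_cases h : k < n
    · simp only [momentSeq, h, dif_pos]
      exact entryMeasurable_coe.comp (measurable_pi_apply _)
    · simp only [momentSeq, h, dif_neg, not_false_eq_true]
      exact entryMeasurable_const _

lemma EntryMeasurable.schur {α : Type*} [MeasurableSpace α]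
    {d : α → ℕ → Matrix (Fin p) (Fin p) ℝ} (hd : ∀ k, EntryMeasurable fun a => d a k) (s m : ℕ) :
    EntryMeasurable fun a => MatrixMoments.schur (d a) s m := by
  have h1 : EntryMeasurable fun a => blockColumn (d a) (s + m) m := fun i j => hd _ _ _
  have h2 : EntryMeasurable fun a => blockHankel (d a) s m := fun i j => hd _ _ _
  exact (hd _).sub ((h1.transpose.mul h2.inv).mul h1)

lemma entryMeasurable_lowerGap (k : ℕ) :
    EntryMeasurable fun S : Fin n → SymMat p => lowerGap (momentSeq S) k :=
  EntryMeasurable.schur entryMeasurable_momentSeq _ _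

lemma entryMeasurable_upperGap (k : ℕ) :
    EntryMeasurable fun S : Fin n → SymMat p => upperGap (momentSeq S) k :=
  EntryMeasurable.schur (fun k => (entryMeasurable_momentSeq k).sub (entryMeasurable_momentSeq _)) _ _

lemma schur_isSymm {d : ℕ → Matrix (Fin p) (Fin p) ℝ} (hd : ∀ k, (d k).IsSymm) (s m : ℕ) :
    (schur d s m).IsSymm :=
  (hd _).sub (isSymm_conj (isSymm_inv (blockHankel_isSymm hd _ _)) _)

lemma measurableSet_interiorSet (n p : ℕ) : MeasurableSet (interiorSet n p) := by
  have h1 : ∀ k, MeasurableSet {S : Fin n → SymMat p | (lowerGap (momentSeq S) k).PosDef} :=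
    fun k => measurableSet_posDef (entryMeasurable_lowerGap k)
      fun S => schur_isSymm (momentSeq_isSymm S) _ _
  have h2 : ∀ k, MeasurableSet {S : Fin n → SymMat p | (upperGap (momentSeq S) k).PosDef} :=
    fun k => measurableSet_posDef (entryMeasurable_upperGap k)
      fun S => schur_isSymm (diffSeq_isSymm (momentSeq_isSymm S)) _ _
  have : interiorSet n p =
      (⋂ k, ⋂ _ : k < n + 1, {S : Fin n → SymMat p | (lowerGap (momentSeq S) k).PosDef}) ∩
      ⋂ k, ⋂ _ : k < n, {S : Fin n → SymMat p | (upperGap (momentSeq S) k).PosDef} := by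
    ext S
    simp [interiorSet]
  rw [this]
  exact (MeasurableSet.iInter fun k => MeasurableSet.iInter fun _ => h1 k).inter
    (MeasurableSet.iInter fun k => MeasurableSet.iInter fun _ => h2 k)

lemma rangeWidth_isSymm (S : Fin n → SymMat p) (k : ℕ) : (rangeWidth S (k + 1)).IsSymm := by
  rw [rangeWidth_eq]
  exact (schur_isSymm (momentSeq_isSymm S) _ _).add
    (schur_isSymm (diffSeq_isSymm (momentSeq_isSymm S)) _ _)

/-- The canonical moments agree with a measurable function on the interior. -/
lemma exists_measurable_canonicalMoment (n p : ℕ) :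
    ∃ F : (Fin n → SymMat p) → Fin n → SymMat p, Measurable F ∧
      ∀ S ∈ interiorSet n p, canonicalMoment S = F S := by
  obtain ⟨g, hg, hgs⟩ := exists_measurable_sqrt p
  set D : Fin n → (Fin n → SymMat p) → SymMat p :=
    fun k S => ⟨rangeWidth S (k + 1), rangeWidth_isSymm S k⟩ with hD
  have hDm : ∀ k, Measurable (D k) := fun k => measurable_of_entryMeasurable (by
    simp only [hD, rangeWidth_eq]
    exact fun i j => (entryMeasurable_lowerGap _ i j).add (entryMeasurable_upperGap _ i j))
  have hR : ∀ k, EntryMeasurable fun S => ((g (D k S)).1)⁻¹ := fun k =>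
    ((entryMeasurable_coe.comp hg).comp (hDm k)).inv
  have hA : ∀ k : ℕ, EntryMeasurable fun S : Fin n → SymMat p => lowerGap (momentSeq S) (k + 1) :=
    fun k => entryMeasurable_lowerGap _
  refine ⟨fun S k => congrMap ((g (D k S)).1)⁻¹ ⟨lowerGap (momentSeq S) (k + 1),
    schur_isSymm (momentSeq_isSymm S) _ _⟩, ?_, fun S hS => ?_⟩
  · refine measurable_pi_iff.2 fun k => measurable_of_entryMeasurable ?_
    exact ((hR k).mul (hA k)).mul (hR k).transpose
  · funext k
    apply Subtype.ext
    have h1 : (g (D k S)).1 = CFC.sqrt (rangeWidth S (k + 1)) :=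
      hgs _ (rangeWidth_posDef hS (by omega)).posSemidef
    rw [congrMap_apply, h1, (isSymm_inv (sqrt_isSymm _)).eq]
    simp only [canonicalMoment]
    rw [lowerMoment_eq, ← momentSeq_succ, sub_sub_cancel]

lemma measurableSet_loewnerInterval (p : ℕ) : MeasurableSet (loewnerInterval p) :=
  (measurableSet_posDef entryMeasurable_coe fun X => X.2).inter
    (measurableSet_posDef ((entryMeasurable_const 1).sub entryMeasurable_coe)
      fun X => Matrix.isSymm_one.sub X.2)

/-- The weight `det (X (1 - X)) ^ e` on the Loewner interval. -/
noncomputable def detWeight (p : ℕ) (e : ℝ) : SymMat p → ENNReal :=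
  (loewnerInterval p).indicator fun X =>
    ENNReal.ofReal (((X : Matrix (Fin p) (Fin p) ℝ) * (1 - X)).det ^ e)

lemma measurable_det_mul_one_sub : Measurable fun X : SymMat p =>
    ((X : Matrix (Fin p) (Fin p) ℝ) * (1 - X)).det :=
  (entryMeasurable_coe.mul ((entryMeasurable_const 1).sub entryMeasurable_coe)).det

lemma measurable_detWeight (p : ℕ) (e : ℝ) : Measurable (detWeight p e) :=
  (measurable_det_mul_one_sub.pow_const e).ennreal_ofReal.indicator
    (measurableSet_loewnerInterval p)

lemma det_mul_one_sub_pos {X : SymMat p} (hX : X ∈ loewnerInterval p) :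
    0 < ((X : Matrix (Fin p) (Fin p) ℝ) * (1 - X)).det := by
  rw [Matrix.det_mul]
  exact mul_pos hX.1.det_pos hX.2.det_pos

lemma detWeight_mul (e h : ℝ) (X : SymMat p) :
    detWeight p e X * ENNReal.ofReal (((X : Matrix (Fin p) (Fin p) ℝ) * (1 - X)).det ^ h) =
      detWeight p (e + h) X := by
  by_cases hX : X ∈ loewnerInterval p
  · have h0 := det_mul_one_sub_pos hX
    rw [detWeight, detWeight, Set.indicator_of_mem hX, Set.indicator_of_mem hX,
      ← ENNReal.ofReal_mul (Real.rpow_nonneg h0.le _), Real.rpow_add h0]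
  · rw [detWeight, detWeight, Set.indicator_of_notMem hX, Set.indicator_of_notMem hX, zero_mul]

lemma canonicalMoment_mem {S : Fin n → SymMat p} (hS : S ∈ interiorSet n p) (k : Fin n) :
    canonicalMoment S k ∈ loewnerInterval p := by
  have hD := rangeWidth_posDef hS (k := k) (by omega)
  have h1 : canonicalMoment S k = congrMap (CFC.sqrt (rangeWidth S (k + 1)))⁻¹
      ⟨lowerGap (momentSeq S) (k + 1), schur_isSymm (momentSeq_isSymm S) _ _⟩ := by
    apply Subtype.ext
    rw [congrMap_apply, (isSymm_inv (sqrt_isSymm _)).eq]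
    simp only [canonicalMoment]
    rw [lowerMoment_eq, ← momentSeq_succ, sub_sub_cancel]
  rw [h1, congrMap_sqrt_inv_mem_iff hD]
  refine ⟨hS.1 _ (by omega), ?_⟩
  rw [rangeWidth_eq, add_sub_cancel_left]
  exact hS.2 _ k.2

lemma measurable_snoc : Measurable fun q : (Fin n → SymMat p) × SymMat p =>
    (Fin.snoc q.1 q.2 : Fin (n + 1) → SymMat p) := by
  refine measurable_pi_iff.2 fun k => ?_
  refine Fin.lastCases ?_ (fun k => ?_) k
  · simp only [Fin.snoc_last]; exact measurable_snd
  · simp only [Fin.snoc_castSucc]; exact (measurable_pi_apply k).comp measurable_fst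

lemma lintegral_tuple_succ {F : (Fin (n + 1) → SymMat p) → ENNReal} (hF : Measurable F) :
    ∫⁻ S, F S ∂(tupleLebesgue (n + 1) p) =
      ∫⁻ S, ∫⁻ s, F (Fin.snoc S s) ∂(symLebesgue p) ∂(tupleLebesgue n p) := by
  have h := measurePreserving_piFinSuccAbove (fun _ : Fin (n + 1) => symLebesgue p) (Fin.last n)
  have h2 := (h.symm _).lintegral_comp hF
  unfold tupleLebesgue
  rw [← h2, lintegral_prod_symm (fun q => F ((MeasurableEquiv.piFinSuccAbove
    (fun _ : Fin (n + 1) => SymMat p) (Fin.last n)).symm q))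
    (hF.comp (MeasurableEquiv.measurable _)).aemeasurable]
  refine lintegral_congr fun S => lintegral_congr fun s => ?_
  congr 1
  exact Fin.insertNth_last' s S

/-- The change of variables from moments to canonical moments. -/
theorem lintegral_interiorSet {f : (Fin n → SymMat p) → ENNReal} (hf : Measurable f) :
    ∫⁻ S in interiorSet n p, f (canonicalMoment S) ∂(tupleLebesgue n p) =
      ∫⁻ U, (∏ k : Fin n, detWeight p (((p : ℝ) + 1) * ((n : ℝ) - ((k : ℕ) + 1)) / 2) (U k)) * f U
        ∂(tupleLebesgue n p) := by
  induction n with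
  | zero =>
    have : interiorSet 0 p = Set.univ := by
      ext S
      simp only [interiorSet, Set.mem_ofPred_eq, Set.mem_univ, iff_true]
      refine ⟨fun k hk => ?_, fun k hk => by omega⟩
      obtain rfl : k = 0 := by omega
      unfold lowerGap
      rw [schur_zero]
      exact Matrix.PosDef.one
    rw [this, Measure.restrict_univ]
    refine lintegral_congr fun S => ?_
    rw [Fin.prod_univ_zero, one_mul]
    congr 1
    exact Subsingleton.elim _ _
  | succ n ih =>
    obtain ⟨F, hF, hFS⟩ := exists_measurable_canonicalMoment (n + 1) p
    set G : (Fin (n + 1) → SymMat p) → ENNReal :=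
      (interiorSet (n + 1) p).indicator fun S => f (canonicalMoment S) with hG
    have hGm : Measurable G := by
      have : G = (interiorSet (n + 1) p).indicator fun S => f (F S) := by
        funext S
        by_cases hS : S ∈ interiorSet (n + 1) p
        · rw [hG, Set.indicator_of_mem hS, Set.indicator_of_mem hS, hFS S hS]
        · rw [hG, Set.indicator_of_notMem hS, Set.indicator_of_notMem hS]
      rw [this]
      exact (hf.comp hF).indicator (measurableSet_interiorSet _ _)
    -- Exponent `0` leaves just the indicator of the Loewner interval: the last canonical moment is
    -- not weighted.
    set H : (Fin n → SymMat p) → ENNReal :=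
      fun U => ∫⁻ u, detWeight p 0 u * f (Fin.snoc U u) ∂(symLebesgue p) with hH
    have hHm : Measurable H := by
      refine Measurable.lintegral_prod_right' (f := fun q : (Fin n → SymMat p) × SymMat p =>
        detWeight p 0 q.2 * f (Fin.snoc q.1 q.2)) ?_
      exact ((measurable_detWeight p 0).comp measurable_snd).mul (hf.comp measurable_snoc)
    have hsn : ∀ U : Fin n → SymMat p,
        Measurable fun u => detWeight p 0 u * f (Fin.snoc U u) := by
      intro U
      have h : Measurable fun u => (Fin.snoc U u : Fin (n + 1) → SymMat p) :=
        measurable_snoc.comp (measurable_const.prodMk measurable_id : Measurable fun u => (U, u))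
      exact (measurable_detWeight p 0).mul (hf.comp h)
    -- `W` at the canonical moments is the Jacobian `(det D)^{(p+1)/2}` of the last variable, by
    -- `det_rangeWidth`.
    set W : (Fin n → SymMat p) → ENNReal := fun U => ∏ k, ENNReal.ofReal
      (((U k : Matrix (Fin p) (Fin p) ℝ) * (1 - (U k : Matrix (Fin p) (Fin p) ℝ))).det ^
        (((p : ℝ) + 1) / 2)) with hW
    have hWm : Measurable W := Finset.measurable_prod _ fun k _ =>
      ((measurable_det_mul_one_sub.comp (measurable_pi_apply k)).pow_const _).ennreal_ofReal
    have hinner : ∀ S : Fin n → SymMat p, ∫⁻ s, G (Fin.snoc S s) ∂(symLebesgue p) =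
        (interiorSet n p).indicator (fun S => W (canonicalMoment S) * H (canonicalMoment S)) S := by
      intro S
      by_cases hS : S ∈ interiorSet n p
      · have hD := rangeWidth_posDef hS (k := n) (by omega)
        rw [Set.indicator_of_mem hS]
        have h1 : ∀ s, G (Fin.snoc S s) = (fun u => detWeight p 0 u *
            f (Fin.snoc (canonicalMoment S) u))
              (congrMap (CFC.sqrt (rangeWidth S (n + 1)))⁻¹ (s - nextLower S)) := by
          intro s
          have hiff := (snoc_mem_interiorSet_iff S s).trans (and_iff_right hS)
          rw [← congrMap_sqrt_inv_mem_iff hD] at hiff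
          simp only [hG]
          by_cases hs : (Fin.snoc S s : Fin (n + 1) → SymMat p) ∈ interiorSet (n + 1) p
          · rw [Set.indicator_of_mem hs, detWeight, Set.indicator_of_mem (hiff.1 hs),
              Real.rpow_zero, ENNReal.ofReal_one, one_mul, canonicalMoment_snoc]
          · rw [Set.indicator_of_notMem hs, detWeight,
              Set.indicator_of_notMem (fun h => hs (hiff.2 h)), zero_mul]
        simp only [h1]
        rw [lintegral_congrMap_inv_sub (sqrt_isSymm _) (det_sqrt_pos hD) _ (hsn _), det_sqrt_pow hD,
          det_rangeWidth hS, ← Real.finsetProd_rpow _ _ fun k _ =>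
            (det_mul_one_sub_pos (canonicalMoment_mem hS k)).le,
          ENNReal.ofReal_prod_of_nonneg fun k _ => Real.rpow_nonneg
            (det_mul_one_sub_pos (canonicalMoment_mem hS k)).le _]
      · rw [Set.indicator_of_notMem hS]
        refine (lintegral_congr fun s => ?_).trans lintegral_zero
        exact Set.indicator_of_notMem
          (fun h => hS ((snoc_mem_interiorSet_iff S s).1 h).1) _
    have hfm2 : Measurable fun U : Fin (n + 1) → SymMat p =>
        (∏ k : Fin (n + 1), detWeight p
          (((p : ℝ) + 1) * (((n + 1 : ℕ) : ℝ) - ((k : ℕ) + 1)) / 2) (U k)) * f U :=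
      (Finset.measurable_prod _ fun k _ =>
        (measurable_detWeight p _).comp (measurable_pi_apply k)).mul hf
    rw [← lintegral_indicator (measurableSet_interiorSet _ _), lintegral_tuple_succ hGm,
      lintegral_congr hinner, lintegral_indicator (measurableSet_interiorSet _ _),
      ih (f := fun U => W U * H U) (hWm.mul hHm), lintegral_tuple_succ hfm2]
    refine lintegral_congr fun U => ?_
    have hlast : ((p : ℝ) + 1) * (((n + 1 : ℕ) : ℝ) - (((Fin.last n : Fin (n + 1)) : ℕ) + 1)) / 2
        = 0 := by
      push_cast [Fin.val_last]; ring
    -- Multiplying by `W` raises every earlier exponent by `(p+1)/2`, which accounts for the step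
    -- from `n` to `n + 1`.
    rw [← mul_assoc, hW, ← Finset.prod_mul_distrib]
    simp only [Fin.prod_univ_castSucc, Fin.snoc_castSucc, Fin.snoc_last, hlast, mul_assoc,
      detWeight_mul]
    rw [lintegral_const_mul _ (hsn U)]
    congr 1
    refine Finset.prod_congr rfl fun k _ => ?_
    congr 1
    push_cast [Fin.val_castSucc]
    ring

end ChangeOfVariables

/-! ### The moment space differs from the interior set by a null set. -/

section Boundary

open Filter Topology

variable {n p : ℕ}

/-- The tuples for which all Hankel matrices are positive semidefinite. -/
def hankelSet (n p : ℕ) : Set (Fin n → SymMat p) :=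
  {S | (∀ s < 2, ∀ m, s + 2 * m < n + 3 → (blockHankel (momentSeq S) s m).PosSemidef) ∧
    ∀ s < 2, ∀ m, s + 2 * m < n + 2 → (blockHankel (diffSeq (momentSeq S)) s m).PosSemidef}

/-- The gaps are rational in the moments, whereas the Hankel matrices are affine in them; this form
is the one suited to convexity arguments. -/
lemma mem_interiorSet_iff (S : Fin n → SymMat p) : S ∈ interiorSet n p ↔
    (∀ s < 2, ∀ m, s + 2 * m < n + 3 → (blockHankel (momentSeq S) s m).PosDef) ∧
    ∀ s < 2, ∀ m, s + 2 * m < n + 2 → (blockHankel (diffSeq (momentSeq S)) s m).PosDef :=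
  and_congr (blockHankel_posDef_iff (momentSeq_isSymm S) (n + 1)).symm
    (blockHankel_posDef_iff (diffSeq_isSymm (momentSeq_isSymm S)) n).symm

lemma exists_momentSeq_eq {c : ℕ → Matrix (Fin p) (Fin p) ℝ} (hc : ∀ k, (c k).IsSymm)
    (hc0 : c 0 = 1) (n : ℕ) : ∃ S : Fin n → SymMat p, ∀ k < n + 1, momentSeq S k = c k := by
  refine ⟨fun k => ⟨c (k + 1), hc _⟩, fun k hk => ?_⟩
  rcases k with _ | k
  · exact hc0.symm
  · exact momentSeq_succ _ ⟨k, by omega⟩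

lemma interiorSet_nonempty (n p : ℕ) : (interiorSet n p).Nonempty := by
  obtain ⟨c, hc, hc0, hA, hB⟩ := exists_gaps_posDef p n
  obtain ⟨S, hS⟩ := exists_momentSeq_eq hc hc0 n
  refine ⟨S, fun k hk => ?_, fun k hk => ?_⟩
  · rw [lowerGap_congr fun i hi => hS i (by omega)]; exact hA k hk
  · rw [upperGap_congr fun i hi => hS i (by omega)]; exact hB k hk

lemma interiorSet_subset_momentSpace : interiorSet n p ⊆ momentSpace n p := by
  intro S hS
  obtain ⟨μ, hμ⟩ := exists_measure_of_gaps (momentSeq_isSymm S) rfl hS.1 hS.2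
  exact ⟨μ, fun j => by rw [hμ _ (by omega), momentSeq_succ]⟩

lemma momentSpace_subset_hankelSet : momentSpace n p ⊆ hankelSet n p := by
  rintro S ⟨μ, hμ⟩
  have h : ∀ k < n + 1, momentSeq S k = μ.moment k := by
    intro k hk
    rcases k with _ | k
    · rw [moment_zero]; rfl
    · rw [← hμ ⟨k, by omega⟩]; exact momentSeq_succ S ⟨k, by omega⟩
  refine ⟨fun s _ m hm => ?_, fun s _ m hm => ?_⟩
  · rw [blockHankel_congr fun i hi => h i (by omega)]
    exact blockHankel_moment_posSemidef μ s m
  · have h2 : ∀ i, i + 2 ≤ s + 2 * m → diffSeq (momentSeq S) i = diffSeq μ.moment i :=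
      fun i hi => by rw [diffSeq, diffSeq, h i (by omega), h (i + 1) (by omega)]
    rw [blockHankel_congr h2]
    exact blockHankel_diffSeq_moment_posSemidef μ s m

lemma momentSeq_combination (S T : Fin n → SymMat p) {a b : ℝ} (hab : a + b = 1) (k : ℕ) :
    momentSeq (a • S + b • T) k = a • momentSeq S k + b • momentSeq T k := by
  rcases k with _ | k
  · simp only [momentSeq]
    rw [← add_smul, hab, one_smul]
  · by_cases h : k < n <;> simp [momentSeq, h]

lemma blockHankel_combination (c d : ℕ → Matrix (Fin p) (Fin p) ℝ) (a b : ℝ) (s m : ℕ) :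
    blockHankel (fun k => a • c k + b • d k) s m = a • blockHankel c s m + b • blockHankel d s m :=
  rfl

lemma blockHankel_momentSeq_combination (S T : Fin n → SymMat p) {a b : ℝ} (hab : a + b = 1)
    (s m : ℕ) : blockHankel (momentSeq (a • S + b • T)) s m =
      a • blockHankel (momentSeq S) s m + b • blockHankel (momentSeq T) s m := by
  rw [← blockHankel_combination, funext (momentSeq_combination S T hab)]

lemma blockHankel_diffSeq_combination (S T : Fin n → SymMat p) {a b : ℝ} (hab : a + b = 1)
    (s m : ℕ) : blockHankel (diffSeq (momentSeq (a • S + b • T))) s m =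
      a • blockHankel (diffSeq (momentSeq S)) s m +
        b • blockHankel (diffSeq (momentSeq T)) s m := by
  rw [← blockHankel_combination]
  congr 1
  funext k
  simp only [diffSeq, momentSeq_combination S T hab, smul_sub]
  abel

lemma convex_hankelSet (n p : ℕ) : Convex ℝ (hankelSet n p) := by
  intro S hS T hT a b ha hb hab
  refine ⟨fun s hs m hm => ?_, fun s hs m hm => ?_⟩
  · rw [blockHankel_momentSeq_combination S T hab]
    exact ((hS.1 s hs m hm).smul ha).add ((hT.1 s hs m hm).smul hb)
  · rw [blockHankel_diffSeq_combination S T hab]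
    exact ((hS.2 s hs m hm).smul ha).add ((hT.2 s hs m hm).smul hb)

/-- Prolong the segment from a point `T` with definite Hankel matrices through `S` to a nearby `R`
still in the set. Then `S` is a convex combination with positive weight on `T`, and definite plus
semidefinite is definite. -/
lemma interior_hankelSet_subset : interior (hankelSet n p) ⊆ interiorSet n p := by
  intro S hS
  obtain ⟨T, hT⟩ := interiorSet_nonempty n p
  rw [mem_interiorSet_iff] at hT ⊢
  have hcont : Continuous fun t : ℝ => S + t • (S - T) := by fun_prop
  have h0 : ∀ᶠ t in 𝓝 (0 : ℝ), S + t • (S - T) ∈ hankelSet n p := by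
    refine hcont.continuousAt.eventually_mem ?_
    rw [zero_smul, add_zero]
    exact mem_interior_iff_mem_nhds.1 hS
  obtain ⟨ε, hε, hmem⟩ := Metric.eventually_nhds_iff.1 h0
  set t := ε / 2 with ht
  have ht0 : 0 < t := by positivity
  have hR := hmem (y := t) (by rw [Real.dist_eq, sub_zero, abs_of_pos ht0]; linarith)
  set R := S + t • (S - T) with hRdef
  have hab : (1 + t)⁻¹ + t * (1 + t)⁻¹ = 1 := by field_simp
  have hSR : S = (1 + t)⁻¹ • R + (t * (1 + t)⁻¹) • T := by
    have h1 : (1 + t) • S = R + t • T := by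
      rw [hRdef, add_smul, one_smul, smul_sub]; abel
    rw [mul_comm, mul_smul, ← smul_add, ← h1, inv_smul_smul₀ (by positivity)]
  rw [hSR]
  refine ⟨fun s hs m hm => ?_, fun s hs m hm => ?_⟩
  · rw [blockHankel_momentSeq_combination R T hab]
    exact ((hT.1 s hs m hm).smul (by positivity)).posSemidef_add
      ((hR.1 s hs m hm).smul (by positivity))
  · rw [blockHankel_diffSeq_combination R T hab]
    exact ((hT.2 s hs m hm).smul (by positivity)).posSemidef_add
      ((hR.2 s hs m hm).smul (by positivity))

/-- Up to a null set, the moment space is the set of tuples with positive definite gaps. -/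
theorem momentSpace_ae_eq : momentSpace n p =ᵐ[tupleLebesgue n p] interiorSet n p := by
  have hnull : tupleLebesgue n p (momentSpace n p \ interiorSet n p) = 0 := by
    refine measure_mono_null ?_ (addHaar_frontier_of_convex (tupleLebesgue n p)
      (convex_hankelSet n p))
    intro S hS
    exact ⟨subset_closure (momentSpace_subset_hankelSet hS.1),
      fun h => hS.2 (interior_hankelSet_subset h)⟩
  refine Filter.EventuallyLE.antisymm (ae_le_set.2 hnull) ?_
  exact interiorSet_subset_momentSpace.eventuallyLE

end Boundary

/-! ### Euler's relation, in extended nonnegative integrals so that no convergence is needed. -/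

section Beta

variable {p : ℕ}

/-- The cone of positive definite matrices. -/
def posDefCone (p : ℕ) : Set (SymMat p) := {X | (X : Matrix (Fin p) (Fin p) ℝ).PosDef}

lemma measurableSet_posDefCone (p : ℕ) : MeasurableSet (posDefCone p) :=
  measurableSet_posDef entryMeasurable_coe fun X => X.2

/-- The integrand of the Gamma integral. -/
noncomputable def gammaKernel (p : ℕ) (a : ℝ) (X : SymMat p) : ℝ :=
  (X : Matrix (Fin p) (Fin p) ℝ).det ^ (a - ((p : ℝ) + 1) / 2) *
    Real.exp (-(X : Matrix (Fin p) (Fin p) ℝ).trace)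

lemma measurable_gammaKernel (p : ℕ) (a : ℝ) : Measurable (gammaKernel p a) :=
  (entryMeasurable_coe.det.pow_const _).mul entryMeasurable_coe.trace.neg.exp

lemma gammaKernel_nonneg (a : ℝ) {X : SymMat p} (hX : X ∈ posDefCone p) : 0 ≤ gammaKernel p a X :=
  mul_nonneg (Real.rpow_nonneg (Matrix.PosDef.det_pos hX).le _) (Real.exp_pos _).le

/-- The Gamma integral as an extended nonnegative number. -/
noncomputable def lgamma (p : ℕ) (a : ℝ) : ENNReal :=
  ∫⁻ X in posDefCone p, ENNReal.ofReal (gammaKernel p a X) ∂(symLebesgue p)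

/-- The integrand of the Beta integral. -/
noncomputable def betaKernel (p : ℕ) (a b : ℝ) : SymMat p → ENNReal :=
  (loewnerInterval p).indicator fun X => ENNReal.ofReal
    ((X : Matrix (Fin p) (Fin p) ℝ).det ^ (a - ((p : ℝ) + 1) / 2) *
      (1 - (X : Matrix (Fin p) (Fin p) ℝ)).det ^ (b - ((p : ℝ) + 1) / 2))

lemma measurable_betaKernel (p : ℕ) (a b : ℝ) : Measurable (betaKernel p a b) :=
  (((entryMeasurable_coe.det.pow_const _).mul
    (((entryMeasurable_const 1).sub entryMeasurable_coe).det.pow_const _)).ennreal_ofReal).indicator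
    (measurableSet_loewnerInterval p)

/-- Traces add, so the exponential depends on `Z` alone, and with `X = Z^{1/2} U Z^{1/2}` both
determinants split off a factor `det Z`. The term `X - 0` matches `lintegral_congrMap_inv_sub`. -/
lemma gammaKernel_mul_gammaKernel (a b : ℝ) {Z : SymMat p} (hZ : Z ∈ posDefCone p) (X : SymMat p) :
    (posDefCone p).indicator (fun X => ENNReal.ofReal (gammaKernel p a X)) X *
      (posDefCone p).indicator (fun X => ENNReal.ofReal (gammaKernel p b X)) (Z - X) =
    ENNReal.ofReal ((Z : Matrix (Fin p) (Fin p) ℝ).det ^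
        (a - ((p : ℝ) + 1) / 2 + (b - ((p : ℝ) + 1) / 2)) *
          Real.exp (-(Z : Matrix (Fin p) (Fin p) ℝ).trace)) *
      betaKernel p a b (congrMap (CFC.sqrt (Z : Matrix (Fin p) (Fin p) ℝ))⁻¹ (X - 0)) := by
  have hZ' : (Z : Matrix (Fin p) (Fin p) ℝ).PosDef := hZ
  have hiff := congrMap_sqrt_inv_mem_iff hZ' X
  rw [sub_zero]
  by_cases h : X ∈ posDefCone p ∧ Z - X ∈ posDefCone p
  · have h1 := h.1
    have h2 := h.2
    have h1' : (X : Matrix (Fin p) (Fin p) ℝ).PosDef := h.1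
    have h2' : ((Z : Matrix (Fin p) (Fin p) ℝ) - X).PosDef := h.2
    rw [Set.indicator_of_mem h1, Set.indicator_of_mem h2, betaKernel,
      Set.indicator_of_mem (hiff.2 h), ← ENNReal.ofReal_mul (gammaKernel_nonneg a h1),
      ← ENNReal.ofReal_mul (mul_nonneg (Real.rpow_nonneg hZ'.det_pos.le _) (Real.exp_pos _).le)]
    congr 1
    rw [one_sub_congrMap_sqrt_inv hZ', congrMap_apply, det_sqrt_inv_mul hZ', det_sqrt_inv_mul hZ',
      gammaKernel, gammaKernel, Submodule.coe_sub, Matrix.trace_sub,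
      Real.div_rpow h1'.det_pos.le hZ'.det_pos.le, Real.div_rpow h2'.det_pos.le hZ'.det_pos.le,
      Real.rpow_add hZ'.det_pos]
    generalize a - ((p : ℝ) + 1) / 2 = α
    generalize b - ((p : ℝ) + 1) / 2 = β
    have e1 := (Real.rpow_pos_of_pos hZ'.det_pos α).ne'
    have e2 := (Real.rpow_pos_of_pos hZ'.det_pos β).ne'
    have e3 : Real.exp (-(Z : Matrix (Fin p) (Fin p) ℝ).trace) =
        Real.exp (-(X : Matrix (Fin p) (Fin p) ℝ).trace) *
          Real.exp (-((Z : Matrix (Fin p) (Fin p) ℝ).trace -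
            (X : Matrix (Fin p) (Fin p) ℝ).trace)) := by
      rw [← Real.exp_add]; congr 1; ring
    rw [e3]
    field_simp
  · rw [betaKernel, Set.indicator_of_notMem (fun h' => h (hiff.1 h')), mul_zero]
    rcases not_and_or.1 h with h | h
    · rw [Set.indicator_of_notMem h, zero_mul]
    · rw [Set.indicator_of_notMem (a := Z - X) h, mul_zero]

/-- Euler's relation between the Gamma and the Beta integral. -/
theorem lgamma_mul_lgamma (p : ℕ) (a b : ℝ) :
    lgamma p a * lgamma p b =
      lgamma p (a + b) * ∫⁻ U, betaKernel p a b U ∂(symLebesgue p) := by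
  set g : ℝ → SymMat p → ENNReal := fun a =>
    (posDefCone p).indicator (fun X => ENNReal.ofReal (gammaKernel p a X)) with hg
  have hgm : ∀ a, Measurable (g a) := fun a =>
    (measurable_gammaKernel p a).ennreal_ofReal.indicator (measurableSet_posDefCone p)
  have hgl : ∀ a, lgamma p a = ∫⁻ X, g a X ∂(symLebesgue p) := fun a =>
    (lintegral_indicator (measurableSet_posDefCone p) _).symm
  have hm : Measurable fun q : SymMat p × SymMat p => g a q.1 * g b (q.2 - q.1) := by
    have : Measurable fun q : SymMat p × SymMat p => q.2 - q.1 :=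
      measurable_of_entryMeasurable ((entryMeasurable_coe.comp measurable_snd).sub
        (entryMeasurable_coe.comp measurable_fst))
    exact ((hgm a).comp measurable_fst).mul ((hgm b).comp this)
  -- Substitute `Z = X + Y` for fixed `X`, exchange the integrals, then substitute `X = Z^{1/2} U
  -- Z^{1/2}` for fixed `Z`. The last Jacobian `(det Z)^{(p+1)/2}` completes the exponent of `det Z`
  -- to `a + b - (p+1)/2`.
  calc lgamma p a * lgamma p b
      = ∫⁻ X, ∫⁻ Z, g a X * g b (Z - X) ∂(symLebesgue p) ∂(symLebesgue p) := by
        rw [hgl, hgl, ← lintegral_mul_const _ (hgm a)]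
        refine lintegral_congr fun X => ?_
        rw [lintegral_sub_right_eq_self (fun Y => g a X * g b Y) X, lintegral_const_mul _ (hgm b)]
    _ = ∫⁻ Z, ∫⁻ X, g a X * g b (Z - X) ∂(symLebesgue p) ∂(symLebesgue p) :=
        lintegral_lintegral_swap hm.aemeasurable
    _ = ∫⁻ Z, g (a + b) Z * ∫⁻ U, betaKernel p a b U ∂(symLebesgue p) ∂(symLebesgue p) := by
        refine lintegral_congr fun Z => ?_
        by_cases hZ : Z ∈ posDefCone p
        · have hZ' : (Z : Matrix (Fin p) (Fin p) ℝ).PosDef := hZ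
          have hZpos := hZ'.det_pos
          simp only [hg, gammaKernel_mul_gammaKernel a b hZ]
          have hcm : Measurable fun X : SymMat p => betaKernel p a b
              (congrMap (CFC.sqrt (Z : Matrix (Fin p) (Fin p) ℝ))⁻¹ (X - 0)) := by
            simp only [sub_zero]
            exact (measurable_betaKernel p a b).comp
              (LinearMap.continuous_of_finiteDimensional _).measurable
          rw [lintegral_const_mul _ hcm,
            lintegral_congrMap_inv_sub (sqrt_isSymm _) (det_sqrt_pos hZ') 0
              (measurable_betaKernel p a b), det_sqrt_pow hZ', Set.indicator_of_mem hZ, ← mul_assoc,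
            ← ENNReal.ofReal_mul (mul_nonneg (Real.rpow_nonneg hZpos.le _) (Real.exp_pos _).le)]
          congr 2
          rw [gammaKernel, mul_right_comm, ← Real.rpow_add hZpos]
          congr 2
          ring
        · have h0 : ∀ X, g a X * g b (Z - X) = 0 := by
            intro X
            by_cases h1 : X ∈ posDefCone p
            · by_cases h2 : Z - X ∈ posDefCone p
              · refine (hZ ?_).elim
                have := Matrix.PosDef.add (A := X.1) (B := (Z - X).1) h1 h2
                rwa [Submodule.coe_sub, add_sub_cancel] at this
              · simp only [hg]
                rw [Set.indicator_of_notMem (a := Z - X) h2, mul_zero]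
            · simp only [hg]
              rw [Set.indicator_of_notMem h1, zero_mul]
          simp only [h0, lintegral_zero]
          simp only [hg]
          rw [Set.indicator_of_notMem hZ, zero_mul]
    _ = lgamma p (a + b) * ∫⁻ U, betaKernel p a b U ∂(symLebesgue p) := by
        rw [lintegral_mul_const _ (hgm _), ← hgl]

end Beta

/-! ### Positivity and finiteness of the Gamma integral. -/

section GammaBounds

variable {p : ℕ}

lemma exists_add_nat_posDef {A : Matrix (Fin p) (Fin p) ℝ} (hA : A.IsSymm) :
    ∃ k : ℕ, (A + (k : ℝ) • (1 : Matrix (Fin p) (Fin p) ℝ)).PosDef := by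
  obtain ⟨k, hk⟩ := exists_nat_gt (∑ i, ∑ j, |A i j|)
  refine ⟨k, Matrix.PosDef.of_dotProduct_mulVec_pos ?_ fun x hx => ?_⟩
  · have h := hA.add (Matrix.isSymm_one.smul (k : ℝ))
    simpa [Matrix.IsHermitian, Matrix.IsSymm, Matrix.conjTranspose_eq_transpose_of_trivial] using h
  · have hs : ∀ i, x i ^ 2 ≤ ∑ i, x i ^ 2 := fun i =>
      Finset.single_le_sum (f := fun i => x i ^ 2) (fun i _ => sq_nonneg _) (Finset.mem_univ i)
    have hpos : 0 < ∑ i, x i ^ 2 := by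
      obtain ⟨i, hi⟩ := Function.ne_iff.1 hx
      exact (sq_pos_of_ne_zero hi).trans_le (hs i)
    have h1 : star x ⬝ᵥ (A + (k : ℝ) • (1 : Matrix (Fin p) (Fin p) ℝ)).mulVec x =
        (∑ i, ∑ j, x i * (A i j * x j)) + k * ∑ i, x i ^ 2 := by
      rw [Matrix.add_mulVec, Matrix.smul_mulVec, Matrix.one_mulVec, dotProduct_add]
      congr 1
      · simp [dotProduct, Matrix.mulVec, Finset.mul_sum]
      · simp only [dotProduct, Finset.mul_sum, Pi.star_apply, star_trivial, Pi.smul_apply,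
          smul_eq_mul]
        exact Finset.sum_congr rfl fun i _ => by ring
    have h2 : -((∑ i, ∑ j, |A i j|) * ∑ i, x i ^ 2) ≤ ∑ i, ∑ j, x i * (A i j * x j) := by
      rw [Finset.sum_mul, ← Finset.sum_neg_distrib]
      refine Finset.sum_le_sum fun i _ => ?_
      rw [Finset.sum_mul, ← Finset.sum_neg_distrib]
      refine Finset.sum_le_sum fun j _ => ?_
      have h3 : |x i * x j| ≤ ∑ i, x i ^ 2 := by
        rw [abs_le]
        constructor <;> nlinarith [hs i, hs j, sq_nonneg (x i + x j), sq_nonneg (x i - x j)]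
      have h4 : |x i * (A i j * x j)| ≤ |A i j| * ∑ i, x i ^ 2 := by
        rw [mul_left_comm, abs_mul]
        exact mul_le_mul_of_nonneg_left h3 (abs_nonneg _)
      exact (abs_le.1 h4).1
    rw [h1]
    nlinarith

/-- Countably many translates of the cone by multiples of the identity cover the space, so by
translation invariance the cone cannot be null. -/
lemma symLebesgue_posDefCone_pos (p : ℕ) : 0 < symLebesgue p (posDefCone p) := by
  rw [pos_iff_ne_zero]
  intro h0
  have hcov : (Set.univ : Set (SymMat p)) ⊆ ⋃ k : ℕ,
      (fun X => X + (k : ℝ) • (⟨1, Matrix.isSymm_one⟩ : SymMat p)) ⁻¹' posDefCone p := by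
    intro X _
    obtain ⟨k, hk⟩ := exists_add_nat_posDef X.2
    exact Set.mem_iUnion.2 ⟨k, hk⟩
  have h1 : symLebesgue p Set.univ = 0 := by
    refine measure_mono_null hcov (measure_iUnion_null fun k => ?_)
    rw [measure_preimage_add_right, h0]
  exact NeZero.ne (symLebesgue p) (Measure.measure_univ_eq_zero.1 h1)

lemma trace_nonneg_of_posSemidef {A : Matrix (Fin p) (Fin p) ℝ} (hA : A.PosSemidef) :
    0 ≤ A.trace := by
  rw [hA.isHermitian.trace_eq_sum_eigenvalues]
  exact Finset.sum_nonneg fun i _ => hA.eigenvalues_nonneg i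

lemma det_le_trace_pow {A : Matrix (Fin p) (Fin p) ℝ} (hA : A.PosSemidef) :
    A.det ≤ A.trace ^ p := by
  have h : ∏ i, hA.isHermitian.eigenvalues i ≤
      ∏ _i : Fin p, ∑ j, hA.isHermitian.eigenvalues j :=
    Finset.prod_le_prod (fun i _ => hA.eigenvalues_nonneg i) fun i _ =>
      Finset.single_le_sum (fun j _ => hA.eigenvalues_nonneg j) (Finset.mem_univ i)
  rw [hA.isHermitian.trace_eq_sum_eigenvalues, hA.isHermitian.det_eq_prod_eigenvalues]
  simpa using h

lemma abs_entry_le_trace {A : Matrix (Fin p) (Fin p) ℝ} (hA : A.PosSemidef) (i j : Fin p) :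
    |A i j| ≤ A.trace := by
  have hd : ∀ i, 0 ≤ A i i := fun i => hA.diag_nonneg
  have hle : ∀ i, A i i ≤ A.trace := fun i =>
    Finset.single_le_sum (f := fun i => A i i) (fun i _ => hd i) (Finset.mem_univ i)
  have hsymm : A j i = A i j := by simpa using hA.isHermitian.apply i j
  have hq : ∀ t : ℝ, 0 ≤ A i i + 2 * t * A i j + t ^ 2 * A j j := by
    intro t
    have h := hA.dotProduct_mulVec_nonneg (Pi.single i 1 + Pi.single j t)
    simp only [star_trivial, Matrix.mulVec_add, add_dotProduct, dotProduct_add,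
      single_dotProduct, Matrix.mulVec_single, MulOpposite.op_one, one_smul, Pi.smul_apply,
      Matrix.col_apply, op_smul_eq_mul, one_mul, hsymm] at h
    linarith
  have h1 := hq 1
  have h2 := hq (-1)
  rw [abs_le]
  constructor <;> linarith [hle i, hle j]

/-- For `a ≥ (p+1)/2` the determinant has a nonnegative exponent and is bounded by a power of the
trace. The trace also bounds the coordinates, and its exponential decay beats any polynomial. -/
lemma gammaKernel_le {a : ℝ} (ha : ((p : ℝ) + 1) / 2 ≤ a) (D : ℕ) :
    ∃ K : ℝ, 0 ≤ K ∧ ∀ x : UpperIndex p → ℝ, symOfUpper p x ∈ posDefCone p →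
      gammaKernel p a (symOfUpper p x) ≤ K * (1 + ‖x‖) ^ (-((D : ℝ))) := by
  set q := a - ((p : ℝ) + 1) / 2 with hq
  have hq0 : 0 ≤ q := by linarith
  set N := ⌈p * q⌉₊ with hN
  refine ⟨(N + D).factorial * Real.exp 1, by positivity, fun x hx => ?_⟩
  have hps := Matrix.PosDef.posSemidef hx
  set X := symOfUpper p x with hX
  have ht0 := trace_nonneg_of_posSemidef hps
  have hdt := det_le_trace_pow hps
  have hdet := (Matrix.PosDef.det_pos hx).le
  have hxt : ‖x‖ ≤ X.1.trace := by
    refine (pi_norm_le_iff_of_nonneg ht0).2 fun ij => ?_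
    have h := abs_entry_le_trace hps ij.1.1 ij.1.2
    have h2 : X.1 ij.1.1 ij.1.2 = x ij := congrFun ((upperEquiv p).left_inv x) ij
    rwa [h2] at h
  rw [gammaKernel, ← hq]
  set t := X.1.trace with ht
  have h1 : X.1.det ^ q ≤ (1 + t) ^ N := by
    calc X.1.det ^ q ≤ (t ^ p) ^ q := Real.rpow_le_rpow hdet hdt hq0
      _ ≤ ((1 + t) ^ p) ^ q := by gcongr; linarith
      _ = (1 + t) ^ (p * q) := by
        rw [← Real.rpow_natCast, ← Real.rpow_mul (by linarith)]
      _ ≤ (1 + t) ^ (N : ℝ) := Real.rpow_le_rpow_of_exponent_le (by linarith) (Nat.le_ceil _)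
      _ = (1 + t) ^ N := Real.rpow_natCast _ _
  -- This is the source of the constant: `(1+t)^(N+D) ≤ (N+D)! · e · e^t`.
  have h2 := Real.pow_div_factorial_le_exp (1 + t) (by linarith) (N + D)
  rw [div_le_iff₀ (by positivity), Real.exp_add] at h2
  rw [Real.rpow_neg (by positivity), Real.rpow_natCast, ← div_eq_mul_inv,
    le_div_iff₀ (by positivity)]
  calc X.1.det ^ q * Real.exp (-t) * (1 + ‖x‖) ^ D
      ≤ (1 + t) ^ N * Real.exp (-t) * (1 + t) ^ D := by gcongr
    _ = (1 + t) ^ (N + D) * Real.exp (-t) := by rw [pow_add]; ring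
    _ ≤ Real.exp 1 * Real.exp t * (N + D).factorial * Real.exp (-t) := by gcongr
    _ = (N + D).factorial * Real.exp 1 := by
      rw [Real.exp_neg]; field_simp

lemma lgamma_lt_top {a : ℝ} (ha : ((p : ℝ) + 1) / 2 ≤ a) : lgamma p a < ⊤ := by
  -- One more than the dimension makes `(1 + ‖x‖)^(-D)` integrable.
  set D := Module.finrank ℝ (UpperIndex p → ℝ) + 1 with hD
  obtain ⟨K, hK, hle⟩ := gammaKernel_le ha D
  have hmeas : Measurable (symOfUpper p) :=
    (upperEquiv p).toContinuousLinearEquiv.continuous.measurable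
  have hfin := finite_integral_one_add_norm (E := UpperIndex p → ℝ) (μ := volume) (r := (D : ℝ))
    (by rw [hD]; push_cast; linarith)
  rw [lgamma, ← lintegral_indicator (measurableSet_posDefCone p), symLebesgue,
    lintegral_map ((measurable_gammaKernel p a).ennreal_ofReal.indicator
      (measurableSet_posDefCone p)) hmeas]
  calc _ ≤ ∫⁻ x : UpperIndex p → ℝ,
        ENNReal.ofReal K * ENNReal.ofReal ((1 + ‖x‖) ^ (-(D : ℝ))) := by
        refine lintegral_mono fun x => ?_
        by_cases hx : symOfUpper p x ∈ posDefCone p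
        · rw [Set.indicator_of_mem hx, ← ENNReal.ofReal_mul hK]
          exact ENNReal.ofReal_le_ofReal (hle x hx)
        · rw [Set.indicator_of_notMem hx]
          exact zero_le
    _ < ⊤ := by
        rw [lintegral_const_mul' _ _ ENNReal.ofReal_ne_top]
        exact ENNReal.mul_lt_top ENNReal.ofReal_lt_top hfin

lemma lgamma_pos (p : ℕ) (a : ℝ) : 0 < lgamma p a := by
  rw [lgamma, setLIntegral_pos_iff (measurable_gammaKernel p a).ennreal_ofReal]
  refine (symLebesgue_posDefCone_pos p).trans_le (measure_mono fun X hX => ⟨?_, hX⟩)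
  have h := mul_pos (Real.rpow_pos_of_pos (Matrix.PosDef.det_pos hX) (a - ((p : ℝ) + 1) / 2))
    (Real.exp_pos (-(X : Matrix (Fin p) (Fin p) ℝ).trace))
  exact (ENNReal.ofReal_pos.2 h).ne'

lemma multiGamma_eq (p : ℕ) (a : ℝ) : multiGamma p a = (lgamma p a).toReal := by
  refine integral_eq_lintegral_of_nonneg_ae ?_ (measurable_gammaKernel p a).aestronglyMeasurable
  refine (ae_restrict_iff' (measurableSet_posDefCone p)).2 (ae_of_all _ fun X hX => ?_)
  exact gammaKernel_nonneg a hX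

end GammaBounds

/-! ### Normalization of the Beta law. -/

section BetaLaw

variable {p : ℕ} {a b : ℝ}

/-- The Beta integral. -/
noncomputable def lbeta (p : ℕ) (a b : ℝ) : ENNReal := ∫⁻ U, betaKernel p a b U ∂(symLebesgue p)

lemma lbeta_eq_div (ha : ((p : ℝ) + 1) / 2 ≤ a) (hb : ((p : ℝ) + 1) / 2 ≤ b) :
    lbeta p a b = lgamma p a * lgamma p b / lgamma p (a + b) := by
  have hp : (0 : ℝ) ≤ ((p : ℝ) + 1) / 2 := by positivity
  rw [lgamma_mul_lgamma, mul_comm, ENNReal.mul_div_cancel_right (lgamma_pos p _).ne'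
    (lgamma_lt_top (by linarith)).ne]
  rfl

lemma lbeta_pos (ha : ((p : ℝ) + 1) / 2 ≤ a) (hb : ((p : ℝ) + 1) / 2 ≤ b) : 0 < lbeta p a b := by
  have hp : (0 : ℝ) ≤ ((p : ℝ) + 1) / 2 := by positivity
  rw [lbeta_eq_div ha hb]
  exact ENNReal.div_pos (mul_ne_zero (lgamma_pos p a).ne' (lgamma_pos p b).ne')
    (lgamma_lt_top (by linarith)).ne

lemma lbeta_lt_top (ha : ((p : ℝ) + 1) / 2 ≤ a) (hb : ((p : ℝ) + 1) / 2 ≤ b) :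
    lbeta p a b < ⊤ := by
  rw [lbeta_eq_div ha hb]
  exact ENNReal.div_lt_top (ENNReal.mul_lt_top (lgamma_lt_top ha) (lgamma_lt_top hb)).ne
    (lgamma_pos p _).ne'

lemma multiBeta_eq (ha : ((p : ℝ) + 1) / 2 ≤ a) (hb : ((p : ℝ) + 1) / 2 ≤ b) :
    multiBeta p a b = (lbeta p a b).toReal := by
  rw [lbeta_eq_div ha hb, ENNReal.toReal_div, ENNReal.toReal_mul, multiBeta, multiGamma_eq,
    multiGamma_eq, multiGamma_eq]

lemma ofReal_betaDensity (ha : ((p : ℝ) + 1) / 2 ≤ a) (hb : ((p : ℝ) + 1) / 2 ≤ b)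
    (X : SymMat p) :
    ENNReal.ofReal (betaDensity p a b X) = (lbeta p a b)⁻¹ * betaKernel p a b X := by
  by_cases hX : X ∈ loewnerInterval p
  · have h := ENNReal.toReal_pos (lbeta_pos ha hb).ne' (lbeta_lt_top ha hb).ne
    rw [betaDensity, betaKernel, Set.indicator_of_mem hX, Set.indicator_of_mem hX,
      multiBeta_eq ha hb, mul_assoc, ENNReal.ofReal_mul (inv_nonneg.2 h.le),
      ENNReal.ofReal_inv_of_pos h, ENNReal.ofReal_toReal (lbeta_lt_top ha hb).ne]
  · rw [betaDensity, betaKernel, Set.indicator_of_notMem hX, Set.indicator_of_notMem hX,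
      ENNReal.ofReal_zero, mul_zero]

lemma isProbabilityMeasure_betaLaw (ha : ((p : ℝ) + 1) / 2 ≤ a) (hb : ((p : ℝ) + 1) / 2 ≤ b) :
    IsProbabilityMeasure (betaLaw p a b) := by
  refine ⟨?_⟩
  rw [betaLaw, withDensity_apply _ MeasurableSet.univ, Measure.restrict_univ,
    lintegral_congr (ofReal_betaDensity ha hb), lintegral_const_mul _ (measurable_betaKernel p a b)]
  exact ENNReal.inv_mul_cancel (lbeta_pos ha hb).ne' (lbeta_lt_top ha hb).ne

lemma detWeight_eq_betaKernel {e : ℝ} (h : a - ((p : ℝ) + 1) / 2 = e) (X : SymMat p) :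
    detWeight p e X = betaKernel p a a X := by
  by_cases hX : X ∈ loewnerInterval p
  · rw [detWeight, betaKernel, Set.indicator_of_mem hX, Set.indicator_of_mem hX, h,
      Matrix.det_mul, Real.mul_rpow hX.1.det_pos.le hX.2.det_pos.le]
  · rw [detWeight, betaKernel, Set.indicator_of_notMem hX, Set.indicator_of_notMem hX]

end BetaLaw

/-! ### Product densities with respect to the product measure. -/

section Product

variable {n p : ℕ}

lemma lintegral_tuple_prod {g : Fin n → SymMat p → ENNReal} (hg : ∀ k, Measurable (g k)) :
    ∫⁻ U, ∏ k, g k (U k) ∂(tupleLebesgue n p) = ∏ k, ∫⁻ X, g k X ∂(symLebesgue p) := by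
  induction n with
  | zero =>
    have h : tupleLebesgue 0 p Set.univ = 1 := by simp [tupleLebesgue]
    simp [h]
  | succ n ih =>
    have hm : Measurable fun U : Fin (n + 1) → SymMat p => ∏ k, g k (U k) :=
      Finset.measurable_prod _ fun k _ => (hg k).comp (measurable_pi_apply k)
    have hm' : Measurable fun U : Fin n → SymMat p => ∏ k : Fin n, g k.castSucc (U k) :=
      Finset.measurable_prod _ fun k _ => (hg _).comp (measurable_pi_apply k)
    rw [lintegral_tuple_succ hm, Fin.prod_univ_castSucc, ← ih fun k => hg k.castSucc,
      ← lintegral_mul_const _ hm']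
    refine lintegral_congr fun U => ?_
    simp only [Fin.prod_univ_castSucc, Fin.snoc_castSucc, Fin.snoc_last]
    rw [lintegral_const_mul _ (hg _)]

lemma tupleLebesgue_withDensity_prod {g : Fin n → SymMat p → ENNReal}
    (hg : ∀ k, Measurable (g k))
    [∀ k, SigmaFinite ((symLebesgue p).withDensity (g k))] :
    (tupleLebesgue n p).withDensity (fun U => ∏ k, g k (U k)) =
      Measure.pi fun k => (symLebesgue p).withDensity (g k) := by
  refine (Measure.pi_eq fun s hs => ?_).symm
  rw [withDensity_apply _ (MeasurableSet.univ_pi hs),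
    ← lintegral_indicator (MeasurableSet.univ_pi hs)]
  have h : ∀ U : Fin n → SymMat p,
      (Set.univ.pi s).indicator (fun U => ∏ k, g k (U k)) U =
        ∏ k, (s k).indicator (g k) (U k) := by
    intro U
    by_cases hU : U ∈ Set.univ.pi s
    · rw [Set.indicator_of_mem hU]
      exact Finset.prod_congr rfl fun k _ =>
        (Set.indicator_of_mem (hU k (Set.mem_univ k)) _).symm
    · rw [Set.indicator_of_notMem hU]
      obtain ⟨k, hk⟩ : ∃ k, U k ∉ s k := by
        by_contra! h
        exact hU fun k _ => h k
      exact (Finset.prod_eq_zero (Finset.mem_univ k) (Set.indicator_of_notMem hk _)).symm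
  rw [lintegral_congr h, lintegral_tuple_prod fun k => (hg k).indicator (hs k)]
  refine Finset.prod_congr rfl fun k _ => ?_
  rw [withDensity_apply _ (hs k), lintegral_indicator (hs k)]

end Product

/-! ### The volume of the moment space and the law of the canonical moments. -/

section CanonicalLaw

variable {n p : ℕ}

/-- The common parameter of the Beta distribution of the canonical moment with index `k`. -/
noncomputable def betaShape (n p : ℕ) (k : Fin n) : ℝ :=
  ((n : ℝ) - ((k : ℕ) + 1) + 1) * ((p : ℝ) + 1) / 2

/-- Equality holds for the last canonical moment, so the Gamma bounds are needed exactly from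
`(p+1)/2` on. -/
lemma betaShape_ge (k : Fin n) : ((p : ℝ) + 1) / 2 ≤ betaShape n p k := by
  have h : ((k : ℕ) : ℝ) + 1 ≤ n := by exact_mod_cast k.2
  have hp : (0 : ℝ) ≤ p := p.cast_nonneg
  rw [betaShape]
  nlinarith

lemma detWeight_eq (k : Fin n) (X : SymMat p) :
    detWeight p (((p : ℝ) + 1) * ((n : ℝ) - ((k : ℕ) + 1)) / 2) X =
      betaKernel p (betaShape n p k) (betaShape n p k) X :=
  detWeight_eq_betaKernel (by rw [betaShape]; ring) X

/-- The volume of the moment space is a product of Beta integrals. -/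
theorem tupleLebesgue_momentSpace (n p : ℕ) : tupleLebesgue n p (momentSpace n p) =
    ∏ k, lbeta p (betaShape n p k) (betaShape n p k) := by
  have h := lintegral_interiorSet (n := n) (p := p) (f := fun _ => 1) measurable_const
  rw [setLIntegral_one] at h
  rw [measure_congr momentSpace_ae_eq, h]
  simp only [mul_one, detWeight_eq]
  exact lintegral_tuple_prod fun k => measurable_betaKernel p _ _

lemma tupleLebesgue_momentSpace_pos (n p : ℕ) : 0 < tupleLebesgue n p (momentSpace n p) := by
  rw [tupleLebesgue_momentSpace, pos_iff_ne_zero]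
  exact Finset.prod_ne_zero_iff.2 fun k _ => (lbeta_pos (betaShape_ge k) (betaShape_ge k)).ne'

lemma tupleLebesgue_momentSpace_lt_top (n p : ℕ) :
    tupleLebesgue n p (momentSpace n p) < ⊤ := by
  rw [tupleLebesgue_momentSpace]
  exact ENNReal.prod_lt_top fun k _ => lbeta_lt_top (betaShape_ge k) (betaShape_ge k)

lemma ofReal_canonicalDensity (U : Fin n → SymMat p) :
    ENNReal.ofReal (canonicalDensity n p U) = (tupleLebesgue n p (momentSpace n p))⁻¹ *
      ∏ k : Fin n, detWeight p (((p : ℝ) + 1) * ((n : ℝ) - ((k : ℕ) + 1)) / 2) (U k) := by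
  have hV : 0 < momentVolume n p :=
    ENNReal.toReal_pos (tupleLebesgue_momentSpace_pos n p).ne'
      (tupleLebesgue_momentSpace_lt_top n p).ne
  rw [canonicalDensity, ENNReal.ofReal_mul (inv_nonneg.2 hV.le), ENNReal.ofReal_inv_of_pos hV,
    momentVolume, ENNReal.ofReal_toReal (tupleLebesgue_momentSpace_lt_top n p).ne,
    ENNReal.ofReal_prod_of_nonneg fun k _ =>
      Set.indicator_nonneg (fun X hX => Real.rpow_nonneg (det_mul_one_sub_pos hX).le _) _]
  congr 1
  refine Finset.prod_congr rfl fun k _ => ?_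
  by_cases hU : U k ∈ loewnerInterval p
  · rw [detWeight, Set.indicator_of_mem hU, Set.indicator_of_mem hU]
  · rw [detWeight, Set.indicator_of_notMem hU, Set.indicator_of_notMem hU, ENNReal.ofReal_zero]

/-- The volume is itself the product of the Beta integrals, so its inverse distributes over the
factors as their normalizing constants. -/
lemma ofReal_canonicalDensity_eq_prod (U : Fin n → SymMat p) :
    ENNReal.ofReal (canonicalDensity n p U) =
      ∏ k, ENNReal.ofReal (betaDensity p (betaShape n p k) (betaShape n p k) (U k)) := by
  simp only [ofReal_canonicalDensity, ofReal_betaDensity (betaShape_ge _) (betaShape_ge _),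
    detWeight_eq, Finset.prod_mul_distrib, tupleLebesgue_momentSpace]
  rw [ENNReal.prod_inv_distrib]
  exact fun i _ j _ _ => Or.inl (lbeta_pos (betaShape_ge i) (betaShape_ge i)).ne'

lemma measurable_betaDensity (p : ℕ) (a b : ℝ) :
    Measurable fun X => ENNReal.ofReal (betaDensity p a b X) := by
  refine Measurable.ennreal_ofReal (Measurable.indicator ?_ (measurableSet_loewnerInterval p))
  exact ((measurable_const.mul (entryMeasurable_coe.det.pow_const _))).mul
    (((entryMeasurable_const 1).sub entryMeasurable_coe).det.pow_const _)

/-- The joint density of the canonical moments is the product of the Beta densities. -/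
theorem withDensity_canonicalDensity (n p : ℕ) :
    (tupleLebesgue n p).withDensity (fun U => ENNReal.ofReal (canonicalDensity n p U)) =
      Measure.pi fun k => betaLaw p (betaShape n p k) (betaShape n p k) := by
  let g : Fin n → SymMat p → ENNReal := fun k X =>
    ENNReal.ofReal (betaDensity p (betaShape n p k) (betaShape n p k) X)
  have hg : ∀ k, (symLebesgue p).withDensity (g k) =
      betaLaw p (betaShape n p k) (betaShape n p k) := fun k => rfl
  have hs : ∀ k, SigmaFinite ((symLebesgue p).withDensity (g k)) := fun k => by
    have := isProbabilityMeasure_betaLaw (p := p) (betaShape_ge k) (betaShape_ge k)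
    rw [hg]
    infer_instance
  have h := tupleLebesgue_withDensity_prod (g := g) fun k => measurable_betaDensity p _ _
  simp only [hg] at h
  rw [← h, funext ofReal_canonicalDensity_eq_prod]

variable {Ω : Type*} [MeasurableSpace Ω] {P : Measure Ω} {S : Ω → Fin n → SymMat p}

lemma ae_mem_interiorSet (hS : AEMeasurable S P)
    (hU : pdf.IsUniform S (momentSpace n p) P (tupleLebesgue n p)) :
    ∀ᵐ ω ∂P, S ω ∈ interiorSet n p := by
  refine ae_of_ae_map (p := fun T => T ∈ interiorSet n p) hS ?_
  rw [hU, ProbabilityTheory.cond, Measure.restrict_congr_set momentSpace_ae_eq]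
  exact Measure.ae_smul_measure (ae_restrict_mem (measurableSet_interiorSet n p)) _

/-- The law of the canonical moments of a uniformly distributed point of the moment space. -/
theorem hasLaw_canonicalMoment (hS : AEMeasurable S P)
    (hU : pdf.IsUniform S (momentSpace n p) P (tupleLebesgue n p)) :
    HasLaw (fun ω => canonicalMoment (S ω))
      ((tupleLebesgue n p).withDensity fun U => ENNReal.ofReal (canonicalDensity n p U)) P := by
  obtain ⟨F, hF, hFS⟩ := exists_measurable_canonicalMoment n p
  -- Measurability is known only on the interior set, which carries the law of `S`; the measurable
  -- `F` replaces the canonical moments from here on.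
  have hae : (fun ω => canonicalMoment (S ω)) =ᵐ[P] F ∘ S := by
    filter_upwards [ae_mem_interiorSet hS hU] with ω hω using hFS _ hω
  refine ⟨(hF.comp_aemeasurable hS).congr hae.symm, ?_⟩
  rw [Measure.map_congr hae, ← AEMeasurable.map_map_of_aemeasurable hF.aemeasurable hS]
  ext t ht
  have hind : Measurable (t.indicator fun _ => (1 : ENNReal)) := measurable_const.indicator ht
  have h := lintegral_interiorSet hind
  have h2 : ∫⁻ T in interiorSet n p, t.indicator (fun _ => (1 : ENNReal)) (canonicalMoment T)
      ∂(tupleLebesgue n p) = (tupleLebesgue n p).restrict (interiorSet n p) (F ⁻¹' t) := by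
    rw [← lintegral_indicator_one (hF ht)]
    refine setLIntegral_congr_fun (measurableSet_interiorSet n p) fun T hT => ?_
    simp only [hFS T hT]
    rfl
  rw [hU, ProbabilityTheory.cond, Measure.restrict_congr_set momentSpace_ae_eq,
    Measure.map_smul, Measure.smul_apply, Measure.map_apply hF ht, ← h2, h, smul_eq_mul,
    withDensity_apply _ ht, ← lintegral_indicator ht, ← lintegral_const_mul']
  · refine lintegral_congr fun U => ?_
    by_cases hU : U ∈ t
    · rw [Set.indicator_of_mem hU, Set.indicator_of_mem hU, ofReal_canonicalDensity, mul_one]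
    · rw [Set.indicator_of_notMem hU, Set.indicator_of_notMem hU, mul_zero, mul_zero]
  · exact ENNReal.inv_ne_top.2 (tupleLebesgue_momentSpace_pos n p).ne'

end CanonicalLaw

end MatrixMoments

theorem theorem3p5 (n p : ℕ) (hn : 1 ≤ n) (hp : 1 ≤ p) :
    (0 < tupleLebesgue n p (momentSpace n p) ∧ tupleLebesgue n p (momentSpace n p) < ⊤) ∧
    ∀ (Ω : Type*) [MeasurableSpace Ω] (P : Measure Ω) [IsProbabilityMeasure P]
      (S : Ω → Fin n → SymMat p), AEMeasurable S P →
      pdf.IsUniform S (momentSpace n p) P (tupleLebesgue n p) →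
      (∀ᵐ ω ∂P, ∀ k : Fin n, (rangeWidth (S ω) (k + 1)).PosDef) ∧
      HasLaw (fun ω => canonicalMoment (S ω))
        ((tupleLebesgue n p).withDensity fun U => ENNReal.ofReal (canonicalDensity n p U)) P ∧
      P.map (fun ω => canonicalMoment (S ω)) ≪ tupleLebesgue n p ∧
      iIndepFun (fun (k : Fin n) ω => canonicalMoment (S ω) k) P ∧
      ∀ k : Fin n, HasLaw (fun ω => canonicalMoment (S ω) k)
        (betaLaw p (((n : ℝ) - ((k : ℕ) + 1) + 1) * ((p : ℝ) + 1) / 2)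
          (((n : ℝ) - ((k : ℕ) + 1) + 1) * ((p : ℝ) + 1) / 2)) P := by
  refine ⟨⟨tupleLebesgue_momentSpace_pos n p, tupleLebesgue_momentSpace_lt_top n p⟩, ?_⟩
  intro Ω _ P _ S hS hU
  have hlaw := hasLaw_canonicalMoment hS hU
  have hprob : ∀ k : Fin n,
      IsProbabilityMeasure (betaLaw p (betaShape n p k) (betaShape n p k)) := fun k =>
    isProbabilityMeasure_betaLaw (betaShape_ge k) (betaShape_ge k)
  have hmk : ∀ k, AEMeasurable (fun ω => canonicalMoment (S ω) k) P := fun k =>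
    (measurable_pi_apply k).comp_aemeasurable hlaw.aemeasurable
  have hpi : P.map (fun ω => canonicalMoment (S ω)) =
      Measure.pi fun k => betaLaw p (betaShape n p k) (betaShape n p k) := by
    rw [hlaw.map_eq, withDensity_canonicalDensity]
  have hk : ∀ k, P.map (fun ω => canonicalMoment (S ω) k) =
      betaLaw p (betaShape n p k) (betaShape n p k) := fun k => by
    rw [← (measurePreserving_eval (fun k => betaLaw p (betaShape n p k) (betaShape n p k)) k).map_eq,
      ← hpi, AEMeasurable.map_map_of_aemeasurable (measurable_pi_apply k).aemeasurable
        hlaw.aemeasurable]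
    rfl
  refine ⟨?_, hlaw, ?_, ?_, fun k => ⟨hmk k, hk k⟩⟩
  · filter_upwards [ae_mem_interiorSet hS hU] with ω hω k
    exact rangeWidth_posDef hω (by omega)
  · rw [hlaw.map_eq]
    exact withDensity_absolutelyContinuous _ _
  · rw [iIndepFun_iff_map_fun_eq_pi_map hmk, funext hk]
    exact hpi
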